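/- Let $\mathrm{sign}(y)=+1$ for $y\ge 0$ and $-1$ for $y<0$, and let $H_d$ be the class of functions $x\mapsto \mathrm{sign}(p(x))$ on $\mathbb{R}$ with $p$ a real polynomial of degree at most $d$. A (randomized, adaptive) label-query learner sees a sample $S$ of $n$ real points, may query the labels $h(x)$ of points $x\in S$ for an unknown hypothesis $h$, and finally outputs a labeling of $S$. Given a distribution $D_H$ on $H_d$, we say that $(U_{[0,1]},D_H,\mathbb{R},H_d)$ is perfectly learnable in $q(n)$ expected queries if there is a learner which, for every $n$, labels every sample of $n$ distinct real points without error under every $h\in H_d$, and which makes at most $q(n)$ queries in expectation over $n$ i.i.d. uniform sample points from $[0,1]$, a hypothesis drawn from $D_H$ (independently of the sample), and the internal randomness of the learner. For $d\ge 1$ and $a\neq 0$, let $D_{a,d}$ be the law of the threshold function of $a\prod_{i=1}^d(x-r_i)$, where the roots $r_1,\dots,r_d$ are i.i.d. uniform on $[0,1]$. **Theorem.** There are absolute constants $c,C,K>0$ such that for all integers $d\ge 1$ and all real $a\ne 0$: 1. (Upper bound.) $(U_{[0,1]},D_{a,d},\mathbb{R},H_d)$ is perfectly learnable in a number $q(n)$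 of expected label queries that satisfies, for all $n\ge 2$, $$q(n)\le C\,d^2\,\log(\max(d,2))\,\log n .$$ 2. (Lower bound.) If $(U_{[0,1]},D_{a,d},\mathbb{R},H_d)$ is perfectly learnable in $q(n)$ expected label queries, then for all $n\ge K d^2$, $$q(n)\ge c\,d\log n .$$ -/

import Mathlib

open MeasureTheory ProbabilityTheory
open scoped NNReal ENNReal

/-- A deterministic adaptive label-query strategy on a sample of `n` points: either stop and output
a labeling of the whole sample, or query the label of the `i`-th point and continue according to the
answer. The label `+1` is `true`, the label `-1` is `false`. -/
inductive QueryTree (n : ℕ) : Type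
  | output (guess : Fin n → Bool) : QueryTree n
  | query (i : Fin n) (next : Bool → QueryTree n) : QueryTree n

namespace QueryTree

/-- The labeling that the strategy outputs when the true labels are `l`. -/
def run {n : ℕ} : QueryTree n → (Fin n → Bool) → (Fin n → Bool)
  | output guess, _ => guess
  | query i next, l => (next (l i)).run l

/-- The number of label queries that the strategy makes when the true labels are `l`. -/
def queries {n : ℕ} : QueryTree n → (Fin n → Bool) → ℕ
  | output _, _ => 0
  | query i next, l => (next (l i)).queries l + 1

instance (n : ℕ) : MeasurableSpace (QueryTree n) := ⊤

end QueryTree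

/-- `(D_X, D_H, X, H)` is perfectly learnable with label queries in `q n` expected queries:
there is a randomized algorithm `A` (seeing the unlabeled sample `S`, it draws a query strategy from
`A n S`) such that, for every `n`, it labels every sample of `n` distinct points without error under
every hypothesis of the class `H`, and its number of queries is at most `q n` in expectation over
`n` independent sample points from `D_X`, a hypothesis from `D_H` and the internal randomness. -/
def PerfectlyLearnable {X : Type*} [MeasurableSpace X] (D_X : Measure X)
    (D_H : Measure (X → Bool)) (H : Set (X → Bool)) (q : ℕ → ℝ≥0) : Prop :=
  ∃ A : (n : ℕ) → Kernel (Fin n → X) (QueryTree n),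
    (∀ n, IsMarkovKernel (A n)) ∧
    (∀ n, ∀ S : Fin n → X, Function.Injective S → ∀ h ∈ H,
      ∀ᵐ t ∂(A n S), t.run (h ∘ S) = h ∘ S) ∧
    (∀ n, ∫⁻ S, ∫⁻ h, ∫⁻ t, (t.queries (h ∘ S) : ℝ≥0∞) ∂(A n S) ∂D_H
        ∂(Measure.pi fun _ : Fin n => D_X) ≤ q n)

/-- The sign of a real number as a label, with the convention `sign 0 = +1`. -/
noncomputable def signLabel (y : ℝ) : Bool := decide (0 ≤ y)

/-- The class `H_d` of univariate polynomial threshold functions of degree at most `d`. -/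
def PTF (d : ℕ) : Set (ℝ → Bool) :=
  {h | ∃ p : Polynomial ℝ, p.natDegree ≤ d ∧ h = fun x => signLabel (p.eval x)}

/-- The uniform distribution on `[0, 1]`, as a distribution on the real line. -/
noncomputable def unif01 : Measure ℝ := volume.restrict (Set.Icc 0 1)

/-- The threshold function of the polynomial with leading coefficient `a` and roots `r`. -/
noncomputable def rootsPTF {d : ℕ} (a : ℝ) (r : Fin d → ℝ) : ℝ → Bool :=
  fun x => signLabel (a * ∏ i, (x - r i))

/-- The law of the threshold function of a polynomial with leading coefficient `a` whose `d` roots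
are independent and uniform on `[0, 1]`. -/
noncomputable def uniformRoots (a : ℝ) (d : ℕ) : Measure (ℝ → Bool) :=
  (Measure.pi fun _ : Fin d => unif01).map (rootsPTF a)

instance : IsProbabilityMeasure unif01 := ⟨by simp [unif01]⟩

lemma rootsPTF_mem_PTF {d : ℕ} (a : ℝ) (r : Fin d → ℝ) : rootsPTF a r ∈ PTF d := by
  refine ⟨Polynomial.C a * ∏ i, (Polynomial.X - Polynomial.C (r i)), ?_, ?_⟩
  · refine (Polynomial.natDegree_C_mul_le _ _).trans ?_
    refine (Polynomial.natDegree_prod_le _ _).trans ?_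
    simp
  · funext x
    simp [rootsPTF, Polynomial.eval_prod]

lemma measurable_signLabel : Measurable signLabel :=
  measurable_to_bool (by
    have : signLabel ⁻¹' {true} = Set.Ici 0 := by
      ext y; simp [signLabel]
    rw [this]; exact measurableSet_Ici)

lemma measurable_rootsPTF {d : ℕ} (a : ℝ) :
    Measurable (rootsPTF a : (Fin d → ℝ) → ℝ → Bool) := by
  refine measurable_pi_lambda _ fun x => measurable_signLabel.comp ?_
  fun_prop

instance (a : ℝ) (d : ℕ) : IsProbabilityMeasure (uniformRoots a d) :=
  Measure.isProbabilityMeasure_map (measurable_rootsPTF a).aemeasurable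

/-! Away from the roots, the label at `x` is the sign of `a` flipped once for each root to the right
of `x`, so labels see only the parity of that number (`signLabel_mul_prod`). Both bounds rest on one
estimate: the expected probability that fewer than `s` sample points lie between some two roots, or
between a root and an endpoint of the interval, is at most `24 d² s / (n + 1)`
(`lintegral_not_separates_le`).

Upper bound. Sort the sample and refine a grid of positions dyadically. A polynomial of degree `d`
gives at most `d` label changes along the sorted sample (`changes_le_of_mem_PTF`). Once the grid
shows `d` changes, a midpoint between equal labels must carry that label, so a level costs at most
`d` queries. Before that all `2 ^ j` midpoints are queried, but this happens only if the grid of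
spacing about `n / 2 ^ j` fails to separate the roots, an event of probability `O(d² / 2 ^ j)`. Each
of the `O(log n)` levels thus costs `O(d²)` on average, while correctness holds for every hypothesis
in the class. The factor `log (max d 2)` is not needed.

Lower bound. A correct strategy identifies at most `2 ^ k` labelings with `k` queries
(`card_run_eq_le`). If the sample meets each of `M` equal cells, the separated root tuples with one
given labeling fill measure at most `d! (4 / M) ^ d`: by parity each root shares its gap with a root
of a fixed reference tuple (`exists_root_same_gap`), and gaps have length at most `2 / M`. With `M`
near `n ^ (3/4)` and `k` near `(d / 8) log₂ n`, the product of the two is small, so more than `k`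
queries are needed with probability bounded below. Randomized learners reduce to single trees by
Tonelli. -/

namespace QueryTree

/-! ### Query trees: batches of queries and counting labelings -/

/-- Query the points `idx k` for the `k` in a list, record the answers in the table `g`, and
continue with the updated table. -/
def queryList {n : ℕ} (idx : ℕ → Fin n) :
    List ℕ → (ℕ → Bool) → ((ℕ → Bool) → QueryTree n) → QueryTree n
  | [], g, c => c g
  | k :: L, g, c => query (idx k) fun b => queryList idx L (Function.update g k b) c

/-- The table `g` after the labels of `idx k` have been recorded for all `k` in `L`. -/
def record {n : ℕ} (idx : ℕ → Fin n) (L : List ℕ) (g : ℕ → Bool) (l : Fin n → Bool) : ℕ → Bool :=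
  fun k => if k ∈ L then l (idx k) else g k

lemma record_cons {n : ℕ} (idx : ℕ → Fin n) (k : ℕ) (L : List ℕ) (g : ℕ → Bool)
    (l : Fin n → Bool) :
    record idx (k :: L) g l = record idx L (Function.update g k (l (idx k))) l := by
  funext j
  by_cases hj : j = k <;> by_cases hL : j ∈ L <;> simp [record, hj, hL, Function.update]

lemma record_nil {n : ℕ} (idx : ℕ → Fin n) (g : ℕ → Bool) (l : Fin n → Bool) :
    record idx [] g l = g := by
  funext k; simp [record]

lemma run_queryList {n : ℕ} (idx : ℕ → Fin n) (L : List ℕ) (g : ℕ → Bool)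
    (c : (ℕ → Bool) → QueryTree n) (l : Fin n → Bool) :
    (queryList idx L g c).run l = (c (record idx L g l)).run l := by
  induction L generalizing g with
  | nil => simp [queryList, record_nil]
  | cons k L ih => rw [queryList, run, ih, record_cons]

lemma queries_queryList {n : ℕ} (idx : ℕ → Fin n) (L : List ℕ) (g : ℕ → Bool)
    (c : (ℕ → Bool) → QueryTree n) (l : Fin n → Bool) :
    (queryList idx L g c).queries l = L.length + (c (record idx L g l)).queries l := by
  induction L generalizing g with
  | nil => simp [queryList, record_nil]
  | cons k L ih => rw [queryList, queries, ih, record_cons, List.length_cons]; ring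

/-- The labelings that a strategy identifies with at most `k` queries number at most `2 ^ k`. -/
lemma card_run_eq_le {n : ℕ} (t : QueryTree n) (k : ℕ) :
    (Finset.univ.filter fun l : Fin n → Bool => t.run l = l ∧ t.queries l ≤ k).card ≤ 2 ^ k := by
  induction t generalizing k with
  | output g =>
    refine le_trans (Finset.card_le_one.2 ?_) Nat.one_le_two_pow
    intro x hx y hy
    rw [← (Finset.mem_filter.1 hx).2.1, ← (Finset.mem_filter.1 hy).2.1]
    rfl
  | query i next ih =>
    cases k with
    | zero => simp [queries]
    | succ k =>
      have hsub : (Finset.univ.filter fun l : Fin n → Bool =>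
          (query i next).run l = l ∧ (query i next).queries l ≤ k + 1) ⊆
          (Finset.univ.filter fun l : Fin n → Bool =>
            (next true).run l = l ∧ (next true).queries l ≤ k) ∪
          (Finset.univ.filter fun l : Fin n → Bool =>
            (next false).run l = l ∧ (next false).queries l ≤ k) := by
        intro l hl
        obtain ⟨-, h1, h2⟩ := Finset.mem_filter.1 hl
        rw [run] at h1
        rw [queries] at h2
        simp only [Finset.mem_filter, Finset.mem_univ, true_and, Finset.mem_union]
        cases h : l i <;> rw [h] at h1 h2
        · exact Or.inr ⟨h1, by omega⟩
        · exact Or.inl ⟨h1, by omega⟩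
      refine (Finset.card_le_card hsub).trans ((Finset.card_union_le _ _).trans ?_)
      have h1 := ih true k
      have h2 := ih false k
      rw [pow_succ]
      omega

end QueryTree

/-! ### Label changes under refinement of a grid -/

/-- The number of changes of a sequence of labels among its first `m + 1` terms. -/
def changes (g : ℕ → Bool) (m : ℕ) : ℕ :=
  ((Finset.range m).filter fun k => g k ≠ g (k + 1)).card

lemma changes_congr {g g' : ℕ → Bool} {m : ℕ} (h : ∀ k ≤ m, g k = g' k) :
    changes g m = changes g' m := by
  unfold changes
  congr 1
  refine Finset.filter_congr fun k hk => ?_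
  have := Finset.mem_range.1 hk
  rw [h k (by omega), h (k + 1) (by omega)]

/-- If refining a sequence of labels to midpoints does not add changes, then a midpoint between two
equal labels has the same label. -/
lemma midpoint_eq_of_changes_le {g : ℕ → Bool} {m : ℕ}
    (h : changes g (2 * m) ≤ changes (fun k => g (2 * k)) m) {k : ℕ} (hk : k < m)
    (he : g (2 * k) = g (2 * (k + 1))) : g (2 * k + 1) = g (2 * k) := by
  by_contra hne
  have hc : changes (fun k => g (2 * k)) m < changes g (2 * m) := by
    -- A change across a coarse interval persists in its left or its right half, so coarse changes
    -- inject into fine ones. Interval `k` contributes nothing to the image, yet a deviating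
    -- midpoint would make `2 * k` a fine change, hence the strict inequality.
    have hmap : ((Finset.range m).filter fun j => g (2 * j) ≠ g (2 * (j + 1))).image
        (fun j => if g (2 * j) ≠ g (2 * j + 1) then 2 * j else 2 * j + 1) ⊆
        ((Finset.range (2 * m)).filter fun j => g j ≠ g (j + 1)).erase (2 * k) := by
      intro i hi
      obtain ⟨j, hj, rfl⟩ := Finset.mem_image.1 hi
      obtain ⟨hj1, hj2⟩ := Finset.mem_filter.1 hj
      have := Finset.mem_range.1 hj1
      have hjk : j ≠ k := by rintro rfl; exact hj2 he
      rw [Finset.mem_erase, Finset.mem_filter, Finset.mem_range]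
      split_ifs with h1
      · exact ⟨by omega, by omega, h1⟩
      · refine ⟨by omega, by omega, ?_⟩
        rw [not_not] at h1
        rw [← h1]
        exact hj2
    have hinj : Set.InjOn (fun j => if g (2 * j) ≠ g (2 * j + 1) then 2 * j else 2 * j + 1)
        ((Finset.range m).filter fun j => g (2 * j) ≠ g (2 * (j + 1)) : Finset ℕ) := by
      intro x _ y _ hxy
      simp only at hxy
      split_ifs at hxy <;> omega
    have h3 := Finset.card_le_card hmap
    rw [Finset.card_image_of_injOn hinj] at h3
    refine lt_of_le_of_lt h3 (Finset.card_erase_lt_of_mem ?_)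
    rw [Finset.mem_filter, Finset.mem_range]
    exact ⟨by omega, fun h => hne h.symm⟩
  omega

/-! ### The dyadic refinement strategy -/

namespace QueryTree

/-- The grid indices that are queried when a grid with `m` intervals and labels `g` is refined:
all midpoints as long as fewer than `d` changes are visible, and otherwise only the midpoints of
the intervals with a change. -/
def refineList (d m : ℕ) (g : ℕ → Bool) : List ℕ :=
  ((List.range m).filter fun k => decide (changes g m < d ∨ g k ≠ g (k + 1))).map (2 * · + 1)

/-- Dyadic refinement: `g` holds the labels on the grid of `m + 1` positions with spacing `2 ^ e`,
`idx` maps positions to points and `pos` maps points to positions. -/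
def refine {n : ℕ} (d : ℕ) (idx : ℕ → Fin n) (pos : Fin n → ℕ) :
    ℕ → ℕ → (ℕ → Bool) → QueryTree n
  | 0, _, g => output fun i => g (pos i)
  -- The default `g (k / 2)` carries known labels to the even positions and guesses the left
  -- neighbour's label at the odd ones; the guess survives only at skipped midpoints.
  | e + 1, m, g => queryList (fun k => idx (k * 2 ^ e)) (refineList d m g) (fun k => g (k / 2))
      fun g' => refine d idx pos e (2 * m) g'

lemma mem_refineList {d m : ℕ} {g : ℕ → Bool} {k : ℕ} :
    k ∈ refineList d m g ↔ ∃ j < m, (changes g m < d ∨ g j ≠ g (j + 1)) ∧ 2 * j + 1 = k := by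
  simp [refineList, and_assoc]

/-- The two cases are added rather than separated, so that the term `d` can be summed over all
levels while the term `m` is later weighted by a small probability. -/
lemma length_refineList_le {d m : ℕ} {g : ℕ → Bool} (h : changes g m ≤ d) :
    (refineList d m g).length ≤ d + if changes g m < d then m else 0 := by
  rw [refineList, List.length_map]
  split_ifs with hd
  · exact (List.length_filter_le _ _).trans (by simp)
  · simp only [hd, false_or, add_zero]
    refine le_trans (le_of_eq ?_) h
    rw [changes, ← List.toFinset_card_of_nodup (List.nodup_range.filter _)]
    congr 1
    ext k
    simp

/-- A midpoint is skipped only when `d` changes are already visible and its two neighbours agree. A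
deviating label would then push the fine grid beyond `d` changes, so the default entry is correct.
-/
lemma record_refineList {n d m : ℕ} {g : ℕ → Bool} {e : ℕ} {idx : ℕ → Fin n}
    {l : Fin n → Bool} (hg : ∀ k ≤ m, g k = l (idx (k * 2 ^ (e + 1))))
    (hc : changes (fun k => l (idx (k * 2 ^ e))) (2 * m) ≤ d) (k : ℕ) (hk : k ≤ 2 * m) :
    record (fun k => idx (k * 2 ^ e)) (refineList d m g) (fun k => g (k / 2)) l k
      = l (idx (k * 2 ^ e)) := by
  have hg' : ∀ k ≤ m, g k = l (idx (2 * k * 2 ^ e)) := by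
    intro k hk
    rw [hg k hk]
    congr 2
    ring
  unfold record
  split_ifs with hL
  · rfl
  · obtain ⟨j, rfl | rfl⟩ := Nat.even_or_odd' k
    · beta_reduce
      rw [show 2 * j / 2 = j by omega, hg' j (by omega)]
    · beta_reduce
      rw [show (2 * j + 1) / 2 = j by omega]
      have hj : j < m := by omega
      have h1 : ¬ (changes g m < d ∨ g j ≠ g (j + 1)) := fun h =>
        hL (mem_refineList.2 ⟨j, hj, h, rfl⟩)
      push Not at h1
      have h2 := midpoint_eq_of_changes_le (g := fun k => l (idx (k * 2 ^ e))) (m := m)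
        (hc.trans (h1.1.trans (changes_congr hg').le)) hj
        (by rw [← hg' j (by omega), ← hg' (j + 1) (by omega)]; exact h1.2)
      rw [hg' j (by omega)]
      exact h2.symm

lemma run_refine {n d : ℕ} {idx : ℕ → Fin n} {pos : Fin n → ℕ} {l : Fin n → Bool}
    (hpos : ∀ i, idx (pos i) = i) (e m : ℕ) (hm : ∀ i, pos i ≤ m * 2 ^ e) (g : ℕ → Bool)
    (hg : ∀ k ≤ m, g k = l (idx (k * 2 ^ e)))
    (hc : ∀ s m, changes (fun k => l (idx (k * s))) m ≤ d) :
    (refine d idx pos e m g).run l = l := by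
  induction e generalizing m g with
  | zero =>
    funext i
    rw [refine, run, hg _ (by simpa using hm i), pow_zero, mul_one, hpos]
  | succ e ih =>
    rw [refine, run_queryList]
    exact ih (2 * m) (fun i => (hm i).trans (le_of_eq (by ring))) _
      (record_refineList hg (hc _ _))

lemma queries_refine {n d : ℕ} {idx : ℕ → Fin n} {pos : Fin n → ℕ} {l : Fin n → Bool}
    (e m : ℕ) (g : ℕ → Bool)
    (hg : ∀ k ≤ m, g k = l (idx (k * 2 ^ e)))
    (hc : ∀ s m, changes (fun k => l (idx (k * s))) m ≤ d) :
    (refine d idx pos e m g).queries l ≤ ∑ j ∈ Finset.range e, (d +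
      if changes (fun k => l (idx (k * 2 ^ (e - j)))) (m * 2 ^ j) < d then m * 2 ^ j else 0) := by
  induction e generalizing m g with
  | zero => simp [refine, queries]
  | succ e ih =>
    rw [refine, queries_queryList, Finset.sum_range_succ', add_comm]
    have hch := changes_congr hg
    refine add_le_add ((ih (2 * m) _ (record_refineList hg (hc _ _))).trans (le_of_eq ?_)) ?_
    · refine Finset.sum_congr rfl fun j _ => ?_
      rw [show e + 1 - (j + 1) = e - j by omega, show 2 * m * 2 ^ j = m * 2 ^ (j + 1) by ring]
    · refine (length_refineList_le (hch.le.trans (hc _ _))).trans (le_of_eq ?_)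
      rw [hch]
      simp

/-- The whole strategy: query the two extreme positions and refine. -/
def dyadic {n : ℕ} (d : ℕ) (idx : ℕ → Fin n) (pos : Fin n → ℕ) (J : ℕ) : QueryTree n :=
  queryList (fun k => idx (k * 2 ^ J)) [0, 1] (fun _ => true) (refine d idx pos J 1)

lemma record_pair {n : ℕ} (idx : ℕ → Fin n) (g : ℕ → Bool) (l : Fin n → Bool) (k : ℕ)
    (hk : k ≤ 1) : record idx [0, 1] g l k = l (idx k) := by
  interval_cases k <;> simp [record]

lemma run_dyadic {n d : ℕ} {idx : ℕ → Fin n} {pos : Fin n → ℕ} {l : Fin n → Bool}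
    (hpos : ∀ i, idx (pos i) = i) {J : ℕ} (hm : ∀ i, pos i ≤ 2 ^ J)
    (hc : ∀ s m, changes (fun k => l (idx (k * s))) m ≤ d) :
    (dyadic d idx pos J).run l = l := by
  rw [dyadic, run_queryList]
  exact run_refine hpos _ _ (by simpa using hm) _ (record_pair _ _ _) hc

lemma queries_dyadic {n d : ℕ} {idx : ℕ → Fin n} {pos : Fin n → ℕ} {l : Fin n → Bool} {J : ℕ}
    (hc : ∀ s m, changes (fun k => l (idx (k * s))) m ≤ d) :
    (dyadic d idx pos J).queries l ≤ 2 + ∑ j ∈ Finset.range J, (d +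
      if changes (fun k => l (idx (k * 2 ^ (J - j)))) (2 ^ j) < d then 2 ^ j else 0) := by
  rw [dyadic, queries_queryList]
  refine add_le_add (by simp) ((queries_refine _ _ _ (record_pair _ _ _) hc).trans (le_of_eq ?_))
  simp

end QueryTree

/-! ### Polynomial signs, roots and parity -/

/-- As `sign 0 = +1`, any small positive shift preserves finitely many labels and makes the values
nonzero. -/
lemma exists_pos_sign_stable (p : Polynomial ℝ) (x : ℕ → ℝ) (m : ℕ) :
    ∃ ε : ℝ, ∀ k ≤ m, (0 ≤ p.eval (x k) → 0 < p.eval (x k) + ε) ∧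
      (p.eval (x k) < 0 → p.eval (x k) + ε < 0) := by
  have h : ∀ᶠ ε in nhdsWithin (0 : ℝ) (Set.Ioi 0), ∀ k ∈ Finset.range (m + 1),
      (0 ≤ p.eval (x k) → 0 < p.eval (x k) + ε) ∧
      (p.eval (x k) < 0 → p.eval (x k) + ε < 0) := by
    refine (Filter.eventually_all_finset _).2 fun k _ => ?_
    rcases le_or_gt 0 (p.eval (x k)) with h | h
    · filter_upwards [self_mem_nhdsWithin] with ε hε
      exact ⟨fun _ => add_pos_of_nonneg_of_pos h hε, fun h' => absurd h h'.not_ge⟩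
    · filter_upwards [Ioo_mem_nhdsGT (neg_pos.2 h)] with ε hε
      exact ⟨fun h' => absurd h h'.not_gt, fun _ => by linarith [hε.2]⟩
  obtain ⟨ε, hε⟩ := h.exists
  exact ⟨ε, fun k hk => hε k (Finset.mem_range.2 (by omega))⟩

/-- A polynomial threshold function of degree `d` changes its label at most `d` times along a
monotone sequence. -/
lemma changes_le_of_mem_PTF {d : ℕ} {h : ℝ → Bool} (hh : h ∈ PTF d) {x : ℕ → ℝ}
    (hx : Monotone x) (m : ℕ) : changes (fun k => h (x k)) m ≤ d := by
  obtain ⟨p, hp, rfl⟩ := hh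
  obtain ⟨ε, hε⟩ := exists_pos_sign_stable p x m
  -- Passing to `P` excludes the zero polynomial and places the roots found by the intermediate
  -- value theorem strictly inside their gaps, so different gaps give different roots.
  set P : Polynomial ℝ := p + Polynomial.C ε with hP
  have hev : ∀ y, P.eval y = p.eval y + ε := fun y => by simp [hP]
  have hP0 : P ≠ 0 := by
    intro h0
    have h1 := hev (x 0)
    rw [h0, Polynomial.eval_zero] at h1
    rcases le_or_gt 0 (p.eval (x 0)) with h | h
    · linarith [(hε 0 (Nat.zero_le _)).1 h]
    · linarith [(hε 0 (Nat.zero_le _)).2 h]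
  have hdeg : P.natDegree ≤ d := by rw [hP, Polynomial.natDegree_add_C]; exact hp
  have hroot : ∀ k ∈ (Finset.range m).filter fun k =>
      signLabel (p.eval (x k)) ≠ signLabel (p.eval (x (k + 1))),
      ∃ y ∈ Set.Ioo (x k) (x (k + 1)), P.eval y = 0 := by
    intro k hk
    obtain ⟨hk1, hk2⟩ := Finset.mem_filter.1 hk
    have hkm := Finset.mem_range.1 hk1
    have hc : ContinuousOn (fun y => P.eval y) (Set.Icc (x k) (x (k + 1))) :=
      P.continuous.continuousOn
    have hle := hx (Nat.le_succ k)
    rcases le_or_gt 0 (p.eval (x k)) with h | h <;>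
      rcases le_or_gt 0 (p.eval (x (k + 1))) with h' | h'
    · simp [signLabel, h, h'] at hk2
    · have := intermediate_value_Ioo' hle hc (show (0 : ℝ) ∈ _ from
        ⟨by rw [hev]; exact (hε _ (by omega)).2 h', by rw [hev]; exact (hε _ (by omega)).1 h⟩)
      simpa using this
    · have := intermediate_value_Ioo hle hc (show (0 : ℝ) ∈ _ from
        ⟨by rw [hev]; exact (hε _ (by omega)).2 h, by rw [hev]; exact (hε _ (by omega)).1 h'⟩)
      simpa using this
    · simp [signLabel, h.not_ge, h'.not_ge] at hk2
  choose! y hy using hroot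
  have hinj : Set.InjOn y ((Finset.range m).filter fun k =>
      signLabel (p.eval (x k)) ≠ signLabel (p.eval (x (k + 1))) : Finset ℕ) := by
    have hlt : ∀ k k', k ∈ ((Finset.range m).filter fun k =>
        signLabel (p.eval (x k)) ≠ signLabel (p.eval (x (k + 1)))) →
        k' ∈ ((Finset.range m).filter fun k =>
        signLabel (p.eval (x k)) ≠ signLabel (p.eval (x (k + 1)))) → k < k' → y k < y k' :=
      fun k k' hk hk' hlt => ((hy k hk).1.2.trans_le (hx hlt)).trans (hy k' hk').1.1
    intro k hk k' hk' he
    rcases lt_trichotomy k k' with h | h | h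
    · exact absurd he (hlt k k' hk hk' h).ne
    · exact h
    · exact absurd he (hlt k' k hk' hk h).ne'
  calc changes (fun k => signLabel (p.eval (x k))) m
      ≤ P.roots.toFinset.card := Finset.card_le_card_of_injOn y
        (fun k hk => by simpa [hP0] using (hy k hk).2) hinj
    _ ≤ P.natDegree := (Multiset.toFinset_card_le _).trans P.card_roots'
    _ ≤ d := hdeg

lemma signLabel_mul_sub {y x r : ℝ} (hy : y ≠ 0) (hx : r ≠ x) :
    signLabel (y * (x - r)) = if x < r then !signLabel y else signLabel y := by
  unfold signLabel
  rcases lt_or_gt_of_ne hx with h | h <;> rcases lt_or_gt_of_ne hy with h' | h'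
  · rw [if_neg h.not_gt, decide_eq_false (mul_neg_of_neg_of_pos h' (sub_pos.2 h)).not_ge,
      decide_eq_false h'.not_ge]
  · rw [if_neg h.not_gt, decide_eq_true (mul_pos h' (sub_pos.2 h)).le, decide_eq_true h'.le]
  · rw [if_pos h, decide_eq_true (mul_pos_of_neg_of_neg h' (sub_neg.2 h)).le,
      decide_eq_false h'.not_ge, Bool.not_false]
  · rw [if_pos h, decide_eq_false (mul_neg_of_pos_of_neg h' (sub_neg.2 h)).not_ge,
      decide_eq_true h'.le, Bool.not_true]

/-- Each factor whose root lies to the right of `x` is negative and flips the sign. -/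
lemma signLabel_mul_prod {ι : Type*} [DecidableEq ι] {a x : ℝ} (ha : a ≠ 0) (s : Finset ι)
    (r : ι → ℝ) (hr : ∀ i ∈ s, r i ≠ x) :
    signLabel (a * ∏ i ∈ s, (x - r i)) =
      xor (signLabel a) (decide (Odd (s.filter fun i => x < r i).card)) := by
  induction s using Finset.induction_on with
  | empty => simp
  | insert i s hi ih =>
    have hr' := fun j hj => hr j (Finset.mem_insert_of_mem hj)
    rw [Finset.prod_insert hi, mul_comm (x - r i), ← mul_assoc, signLabel_mul_sub
      (mul_ne_zero ha (Finset.prod_ne_zero_iff.2 fun j hj => sub_ne_zero.2 (hr' j hj).symm))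
      (hr i (Finset.mem_insert_self _ _)), ih hr', Finset.filter_insert]
    split_ifs with h
    · rw [Finset.card_insert_of_notMem (by simp [hi])]
      by_cases ho : Odd (s.filter fun i => x < r i).card <;> simp [ho, Nat.odd_add_one]
    · rfl

lemma rootsPTF_eq_iff {d : ℕ} {a : ℝ} (ha : a ≠ 0) {r r' : Fin d → ℝ} {x x' : ℝ}
    (hr : ∀ i, r i ≠ x) (hr' : ∀ i, r' i ≠ x') :
    rootsPTF a r x = rootsPTF a r' x' ↔
      (Odd (Finset.univ.filter fun i => x < r i).card ↔
        Odd (Finset.univ.filter fun i => x' < r' i).card) := by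
  rw [rootsPTF, rootsPTF, signLabel_mul_prod ha _ _ fun i _ => hr i,
    signLabel_mul_prod ha _ _ fun i _ => hr' i]
  simp

/-- If a monotone sequence separates the roots, then every root shows up as a change. -/
lemma le_changes_rootsPTF {d : ℕ} {a : ℝ} (ha : a ≠ 0) {r : Fin d → ℝ} {x : ℕ → ℝ}
    (hx : Monotone x) {m : ℕ} (hne : ∀ i k, r i ≠ x k) (h0 : ∀ i, x 0 < r i)
    (hm : ∀ i, r i < x m)
    (hsep : ∀ i j k, r i ∈ Set.Ioo (x k) (x (k + 1)) → r j ∈ Set.Ioo (x k) (x (k + 1)) → i = j) :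
    d ≤ changes (fun k => rootsPTF a r (x k)) m := by
  have hk : ∀ i, ∃ k < m, r i ∈ Set.Ioo (x k) (x (k + 1)) := by
    intro i
    have hex : ∃ k, r i < x k := ⟨m, hm i⟩
    have hpos : Nat.find hex ≠ 0 := fun h => absurd (Nat.find_spec hex) (by rw [h]; exact (h0 i).not_gt)
    obtain ⟨k, hk⟩ := Nat.exists_eq_succ_of_ne_zero hpos
    refine ⟨k, ?_, ?_, ?_⟩
    · have := Nat.find_min' hex (hm i)
      omega
    · have := Nat.find_min hex (m := k) (by omega)
      exact lt_of_le_of_ne (not_lt.1 this) (hne i k).symm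
    · have := Nat.find_spec hex
      rwa [hk] at this
  choose k hkm hk using hk
  have hinj : Function.Injective k := fun i j hij => hsep i j (k i) (hk i) (by rw [hij]; exact hk j)
  have hcard := Finset.card_le_card_of_injOn (s := Finset.univ)
    (t := (Finset.range m).filter fun j => rootsPTF a r (x j) ≠ rootsPTF a r (x (j + 1))) k ?_
    hinj.injOn
  · simpa [changes] using hcard
  · intro i _
    simp only [Finset.coe_filter, Finset.mem_range, Set.mem_ofPred_eq]
    refine ⟨hkm i, ?_⟩
    rw [Ne, rootsPTF_eq_iff ha (fun j => hne j _) (fun j => hne j _)]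
    -- Crossing this gap loses the root `i` and no other, so the parity flips.
    have : (Finset.univ.filter fun j => x (k i) < r j) =
        insert i (Finset.univ.filter fun j => x (k i + 1) < r j) := by
      ext j
      simp only [Finset.mem_filter, Finset.mem_univ, true_and, Finset.mem_insert]
      constructor
      · intro h
        by_cases h' : x (k i + 1) < r j
        · exact Or.inr h'
        · exact Or.inl (hsep j i (k i) ⟨h, lt_of_le_of_ne (not_lt.1 h') (hne j _)⟩ (hk i))
      · rintro (rfl | h)
        · exact (hk j).1
        · exact (hx (Nat.le_succ _)).trans_lt h
    rw [this, Finset.card_insert_of_notMem (by simpa using (hk i).2.le), Nat.odd_add_one]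
    tauto

/-- If two tuples of roots give the same labels on a sample and the sample separates the first
tuple, then every root of the first tuple shares its gap with a root of the second. -/
lemma exists_root_same_gap {n d : ℕ} {a : ℝ} (ha : a ≠ 0) {r r' : Fin d → ℝ} {S : Fin n → ℝ}
    (hr01 : ∀ l, r l ∈ Set.Ioo (0 : ℝ) 1) (hr01' : ∀ l, r' l ∈ Set.Ioo (0 : ℝ) 1)
    (hr : ∀ l i, r l ≠ S i) (hr' : ∀ l i, r' l ≠ S i)
    (hlab : ∀ i, rootsPTF a r (S i) = rootsPTF a r' (S i))
    (hsep : ∀ l l', l ≠ l' → ∃ i, S i ∈ Set.uIoo (r l) (r l')) (l : Fin d) :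
    ∃ l', ∀ i, S i ∉ Set.uIoo (r l) (r' l') := by
  classical
  -- The sentinels `0` and `1` give every root two neighbours in `P`. Parities agree there without
  -- looking at labels: all `d` roots lie right of `0`, none right of `1`.
  set P : Finset ℝ := insert 0 (insert 1 (Finset.univ.image S)) with hP
  have hrP : ∀ l, ∀ p ∈ P, r l ≠ p := by
    intro l p hp
    simp only [hP, Finset.mem_insert, Finset.mem_image, Finset.mem_univ, true_and] at hp
    rcases hp with rfl | rfl | ⟨i, rfl⟩
    · exact (hr01 l).1.ne'
    · exact (hr01 l).2.ne
    · exact hr l i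
  have hpar : ∀ p ∈ P, (Odd (Finset.univ.filter fun i => p < r i).card ↔
        Odd (Finset.univ.filter fun i => p < r' i).card) := by
    intro p hp
    simp only [hP, Finset.mem_insert, Finset.mem_image, Finset.mem_univ, true_and] at hp
    rcases hp with rfl | rfl | ⟨i, rfl⟩
    · rw [Finset.filter_true_of_mem fun i _ => (hr01 i).1,
        Finset.filter_true_of_mem fun i _ => (hr01' i).1]
    · rw [Finset.filter_false_of_mem fun i _ => (hr01 i).2.le.not_gt,
        Finset.filter_false_of_mem fun i _ => (hr01' i).2.le.not_gt]
    · exact (rootsPTF_eq_iff ha (fun j => hr j i) (fun j => hr' j i)).1 (hlab i)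
  obtain ⟨s, hs, hsmax⟩ := (P.filter (· < r l)).exists_max_image id
    ⟨0, by simp [hP, (hr01 l).1]⟩
  obtain ⟨t, ht, htmin⟩ := (P.filter (r l < ·)).exists_min_image id
    ⟨1, by simp [hP, (hr01 l).2]⟩
  obtain ⟨hsP, hsl⟩ := Finset.mem_filter.1 hs
  obtain ⟨htP, htl⟩ := Finset.mem_filter.1 ht
  simp only [id, Finset.mem_filter, and_imp] at hsmax htmin
  have hgap : ∀ i, S i ≤ s ∨ t ≤ S i := by
    intro i
    have hi : S i ∈ P := by simp [hP]
    rcases lt_or_gt_of_ne (hr l i) with h | h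
    · exact Or.inr (htmin _ hi h)
    · exact Or.inl (hsmax _ hi h)
  have hno : ∀ u v, s ≤ u → u ≤ t → s ≤ v → v ≤ t → ∀ i, S i ∉ Set.uIoo u v := by
    intro u v hu hu' hv hv' i hi
    rcases hgap i with h | h
    · exact absurd (le_min hu hv) (not_le.2 (hi.1.trans_le h))
    · exact absurd (max_le hu' hv') (not_le.2 (h.trans_lt hi.2))
  have hst : ∀ (ρ : Fin d → ℝ), (Finset.univ.filter fun i => s < ρ i).card =
      (Finset.univ.filter fun i => t < ρ i).card +
        (Finset.univ.filter fun i => s < ρ i ∧ ρ i ≤ t).card := by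
    intro ρ
    rw [← Finset.card_union_of_disjoint]
    · congr 1
      ext i
      simp only [Finset.mem_filter, Finset.mem_univ, true_and, Finset.mem_union]
      have := hsl.trans htl
      constructor
      · intro h
        rcases lt_or_ge t (ρ i) with h' | h'
        · exact Or.inl h'
        · exact Or.inr ⟨h, h'⟩
      · rintro (h | h)
        · exact this.trans h
        · exact h.1
    · rw [Finset.disjoint_filter]
      intro i _ h h'
      exact absurd h h'.2.not_gt
  -- The first tuple has exactly one root between the neighbours `s` and `t`. Equal parities at both
  -- ends force an odd number of roots of the second tuple there, hence at least one.
  have hone : (Finset.univ.filter fun i => s < r i ∧ r i ≤ t) = {l} := by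
    ext j
    simp only [Finset.mem_filter, Finset.mem_univ, true_and, Finset.mem_singleton]
    refine ⟨fun hj => ?_, fun hj => hj ▸ ⟨hsl, htl.le⟩⟩
    by_contra hne
    obtain ⟨i, hi⟩ := hsep j l hne
    exact hno _ _ hj.1.le hj.2 hsl.le htl.le i hi
  have h1 := hpar s hsP
  have h2 := hpar t htP
  rw [hst r, hst r', hone, Finset.card_singleton, Nat.odd_add_one, h2] at h1
  have hne : (Finset.univ.filter fun i => s < r' i ∧ r' i ≤ t).Nonempty := by
    by_contra he
    rw [Finset.not_nonempty_iff_eq_empty] at he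
    rw [he, Finset.card_empty, add_zero] at h1
    tauto
  obtain ⟨l', hl'⟩ := hne
  obtain ⟨-, h3, h4⟩ := Finset.mem_filter.1 hl'
  exact ⟨l', hno _ _ hsl.le htl.le h3.le h4⟩

/-! ### Few sample points between two random points -/

open Classical in
/-- The number of sample points strictly between `u` and `v`. -/
noncomputable def between {n : ℕ} (S : Fin n → ℝ) (u v : ℝ) : ℕ :=
  (Finset.univ.filter fun i => S i ∈ Set.uIoo u v).card

lemma one_le_between {n : ℕ} {S : Fin n → ℝ} {u v : ℝ} :
    1 ≤ between S u v ↔ ∃ i, S i ∈ Set.uIoo u v := by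
  classical
  rw [between, Nat.one_le_iff_ne_zero, Finset.card_ne_zero, Finset.filter_nonempty_iff]
  simp

lemma measurable_between {n : ℕ} {α : Type*} [MeasurableSpace α] {S : α → Fin n → ℝ}
    {u v : α → ℝ} (hS : Measurable S) (hu : Measurable u) (hv : Measurable v) :
    Measurable fun p => between (S p) (u p) (v p) := by
  classical
  unfold between
  simp_rw [Finset.card_filter]
  refine Finset.measurable_fun_sum _ fun i _ => Measurable.ite ?_ measurable_const measurable_const
  have hi : Measurable fun p => S p i := (measurable_pi_apply i).comp hS
  exact (measurableSet_lt (hu.min hv) hi).inter (measurableSet_lt hi (hu.max hv))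

lemma measurableSet_between_lt {n : ℕ} {α : Type*} [MeasurableSpace α] {S : α → Fin n → ℝ}
    {u v : α → ℝ} (hS : Measurable S) (hu : Measurable u) (hv : Measurable v) (s : ℕ) :
    MeasurableSet {p | between (S p) (u p) (v p) < s} :=
  measurable_between hS hu hv (MeasurableSet.of_discrete (s := Set.Iio s))

lemma measurableSet_uIoo (u v : ℝ) : MeasurableSet (Set.uIoo u v) := measurableSet_Ioo

lemma unif01_real_uIoo {u v : ℝ} (hu : u ∈ Set.Icc (0 : ℝ) 1) (hv : v ∈ Set.Icc (0 : ℝ) 1) :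
    unif01.real (Set.uIoo u v) = |u - v| := by
  have hsub : Set.uIoo u v ⊆ Set.Icc 0 1 := fun x hx =>
    ⟨(le_min hu.1 hv.1).trans hx.1.le, hx.2.le.trans (max_le hu.2 hv.2)⟩
  rw [unif01, measureReal_restrict_apply (measurableSet_uIoo u v), Set.inter_eq_left.2 hsub, Set.uIoo,
    Measure.real, Real.volume_Ioo, ENNReal.toReal_ofReal (sub_nonneg.2 inf_le_sup),
    max_sub_min_eq_abs']

/-- The number of sample points between two given points is rarely small. -/
lemma measure_between_lt_le {n s : ℕ} (hs : 1 ≤ s) {u v : ℝ} (hu : u ∈ Set.Icc (0 : ℝ) 1)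
    (hv : v ∈ Set.Icc (0 : ℝ) 1) :
    (Measure.pi fun _ : Fin n => unif01) {S | between S u v < s} ≤
      ENNReal.ofReal (2 * (1 - 1 / (2 * s) * |u - v|) ^ n) := by
  classical
  have hs' : (1 : ℝ) ≤ s := by exact_mod_cast hs
  -- Chernoff's method: Markov's inequality for `t ^ between S u v`, whose mean factorizes by
  -- independence. With this `t`, Bernoulli's inequality gives `t ^ s ≥ 1 / 2`, the source of the
  -- factor `2` in the bound.
  set t : ℝ := 1 - 1 / (2 * s) with ht
  have hs0 : (1 : ℝ) / (2 * s) ≤ 1 / 2 := by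
    apply one_div_le_one_div_of_le <;> linarith
  have hs1 : (0 : ℝ) < 1 / (2 * s) := by positivity
  have ht0 : 0 ≤ t := by linarith
  have ht1 : t ≤ 1 := by linarith
  set f : ℝ → ℝ := fun x => if x ∈ Set.uIoo u v then t else 1 with hf
  have hmf : Measurable f := Measurable.ite (measurableSet_uIoo u v) measurable_const measurable_const
  have hf0 : ∀ x, 0 ≤ f x := fun x => by
    simp only [hf]; split_ifs <;> linarith
  have hf1 : ∀ x, f x ≤ 1 := fun x => by
    simp only [hf]; split_ifs <;> linarith
  have hprod : ∀ S : Fin n → ℝ, ∏ i, f (S i) = t ^ between S u v := by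
    intro S
    simp only [hf, between]
    rw [Finset.prod_ite]
    simp
  have hint : ∫ x, f x ∂unif01 = 1 - 1 / (2 * s) * |u - v| := by
    have h1 : ∀ x, f x = 1 - (Set.uIoo u v).indicator (fun _ => 1 / (2 * (s : ℝ))) x := by
      intro x
      simp only [hf, Set.indicator]
      split_ifs <;> simp [ht]
    simp_rw [h1]
    rw [integral_sub (integrable_const _) ((integrable_const _).indicator (measurableSet_uIoo u v)),
      integral_indicator (measurableSet_uIoo u v), setIntegral_const, unif01_real_uIoo hu hv]
    simp [mul_comm]
  have hI : ∫ S : Fin n → ℝ, ∏ i, f (S i) ∂(Measure.pi fun _ => unif01) =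
      (1 - 1 / (2 * s) * |u - v|) ^ n := by
    rw [integral_fintype_prod_eq_pow, hint, Fintype.card_fin]
  have hM := mul_meas_ge_le_integral_of_nonneg (μ := Measure.pi fun _ : Fin n => unif01)
    (f := fun S => ∏ i, f (S i)) (Filter.Eventually.of_forall fun S =>
      Finset.prod_nonneg fun i _ => hf0 _) (Integrable.of_bound (C := 1)
        (Measurable.aestronglyMeasurable (by fun_prop)) (Filter.Eventually.of_forall fun S => by
          rw [Real.norm_of_nonneg (Finset.prod_nonneg fun i _ => hf0 _)]
          exact Finset.prod_le_one (fun i _ => hf0 _) fun i _ => hf1 _)) (1 / 2)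
  rw [hI] at hM
  rw [← ofReal_measureReal]
  refine ENNReal.ofReal_le_ofReal ?_
  refine le_trans (measureReal_mono (s₂ := {S | 1 / 2 ≤ ∏ i, f (S i)}) (fun S hS => ?_))
    (by linarith)
  simp only [Set.mem_ofPred_eq] at hS ⊢
  rw [hprod]
  have hb := one_add_mul_le_pow (a := -(1 / (2 * (s : ℝ)))) (by linarith) s
  have h2 : (1 : ℝ) + s * -(1 / (2 * s)) = 1 / 2 := by field_simp; norm_num
  rw [h2, ← sub_eq_add_neg] at hb
  exact hb.trans (pow_le_pow_of_le_one ht0 ht1 hS.le)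

lemma integral_pow_affine_le {n : ℕ} {c x : ℝ} (hc : 0 < c) (hcx : c * x ≤ 1) :
    ∫ y in (0 : ℝ)..x, (1 - c * (x - y)) ^ n ≤ 1 / (c * (n + 1)) := by
  have h : ∀ y, (1 - c * (x - y)) ^ n = (c * y + (1 - c * x)) ^ n := fun y => by ring
  simp_rw [h]
  rw [intervalIntegral.integral_comp_mul_add (fun z => z ^ n) hc.ne', integral_pow, smul_eq_mul]
  have h0 : 0 ≤ (1 - c * x) ^ (n + 1) := pow_nonneg (by linarith) _
  have h1 : c * x + (1 - c * x) = 1 := by ring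
  rw [mul_zero, zero_add, h1, one_pow, one_div, mul_inv, div_eq_mul_inv]
  refine mul_le_mul_of_nonneg_left ?_ (by positivity)
  exact mul_le_of_le_one_left (by positivity) (by linarith)

/-- Splitting at `x` leaves two integrals of powers of affine functions, each at most `2 s / (n +
1)`; the factor `2` from the tail bound makes `8 s / (n + 1)`. -/
lemma lintegral_pow_abs_le {n s : ℕ} (hs : 1 ≤ s) {x : ℝ} (hx : x ∈ Set.Icc (0 : ℝ) 1) :
    ∫⁻ y, ENNReal.ofReal (2 * (1 - 1 / (2 * s) * |x - y|) ^ n) ∂unif01 ≤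
      ENNReal.ofReal (8 * s / (n + 1)) := by
  have hs' : (1 : ℝ) ≤ s := by exact_mod_cast hs
  set c : ℝ := 1 / (2 * s) with hc
  have hc0 : 0 < c := by positivity
  have hc1 : c ≤ 1 := by
    rw [hc, div_le_one (by positivity)]; linarith
  have hcont : Continuous fun y => 2 * (1 - c * |x - y|) ^ n := by fun_prop
  have hii : ∀ a b, IntervalIntegrable (fun y => 2 * (1 - c * |x - y|) ^ n) volume a b :=
    fun a b => hcont.intervalIntegrable a b
  rw [← ofReal_integral_eq_lintegral_ofReal]
  · refine ENNReal.ofReal_le_ofReal ?_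
    rw [unif01, integral_Icc_eq_integral_Ioc, ← intervalIntegral.integral_of_le zero_le_one,
      ← intervalIntegral.integral_add_adjacent_intervals (hii 0 x) (hii x 1)]
    have h1 : ∫ y in (0 : ℝ)..x, 2 * (1 - c * |x - y|) ^ n =
        2 * ∫ y in (0 : ℝ)..x, (1 - c * (x - y)) ^ n := by
      rw [← intervalIntegral.integral_const_mul]
      refine intervalIntegral.integral_congr fun y hy => ?_
      rw [Set.uIcc_of_le hx.1] at hy
      simp only [abs_of_nonneg (sub_nonneg.2 hy.2)]
    have h2 : ∫ y in x..1, 2 * (1 - c * |x - y|) ^ n =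
        2 * ∫ y in (0 : ℝ)..(1 - x), (1 - c * (1 - x - y)) ^ n := by
      rw [← intervalIntegral.integral_const_mul]
      have := intervalIntegral.integral_comp_sub_left (a := x) (b := 1)
        (fun y => 2 * (1 - c * (1 - x - y)) ^ n) 1
      rw [sub_self] at this
      rw [← this]
      refine intervalIntegral.integral_congr fun y hy => ?_
      rw [Set.uIcc_of_le hx.2] at hy
      simp only [abs_of_nonpos (sub_nonpos.2 hy.1)]
      ring
    have h3 := integral_pow_affine_le (n := n) hc0
      (show c * x ≤ 1 from mul_le_one₀ hc1 hx.1 hx.2)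
    have h4 := integral_pow_affine_le (n := n) hc0
      (show c * (1 - x) ≤ 1 from mul_le_one₀ hc1 (by linarith [hx.2]) (by linarith [hx.1]))
    have h5 : 1 / (c * (n + 1)) = 2 * s / (n + 1) := by
      rw [hc]; field_simp
    rw [h5] at h3 h4
    rw [h1, h2]
    have h6 : 8 * (s : ℝ) / (n + 1) = 4 * (2 * s / (n + 1)) := by ring
    linarith
  · exact hcont.integrableOn_Icc
  · refine (ae_restrict_iff' measurableSet_Icc).2 (Filter.Eventually.of_forall fun y hy => ?_)
    have h1 : |x - y| ≤ 1 := abs_le.2 ⟨by linarith [hx.1, hy.2], by linarith [hx.2, hy.1]⟩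
    have h2 : c * |x - y| ≤ 1 := mul_le_one₀ hc1 (abs_nonneg _) h1
    exact mul_nonneg zero_le_two (pow_nonneg (by linarith) _)

lemma ae_unif01_mem : ∀ᵐ x ∂unif01, x ∈ Set.Icc (0 : ℝ) 1 := ae_restrict_mem measurableSet_Icc

instance : NullSingletonClass unif01 := by unfold unif01; infer_instance

/-- Tonelli lets the sample be averaged first for fixed `y`, where the tail bound applies. -/
lemma lintegral_unif01_between_lt_le {n s : ℕ} (hs : 1 ≤ s) {x : ℝ}
    (hx : x ∈ Set.Icc (0 : ℝ) 1) :
    ∫⁻ S, unif01 {y | between S x y < s} ∂(Measure.pi fun _ : Fin n => unif01) ≤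
      ENNReal.ofReal (8 * s / (n + 1)) := by
  have hm : MeasurableSet {p : (Fin n → ℝ) × ℝ | between p.1 x p.2 < s} :=
    measurableSet_between_lt measurable_fst measurable_const measurable_snd s
  calc _ = ((Measure.pi fun _ : Fin n => unif01).prod unif01)
        {p : (Fin n → ℝ) × ℝ | between p.1 x p.2 < s} := by
          rw [Measure.prod_apply hm]; rfl
    _ = ∫⁻ y, (Measure.pi fun _ : Fin n => unif01) {S | between S x y < s} ∂unif01 := by
          rw [Measure.prod_apply_symm hm]; rfl
    _ ≤ ∫⁻ y, ENNReal.ofReal (2 * (1 - 1 / (2 * s) * |x - y|) ^ n) ∂unif01 := by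
          refine lintegral_mono_ae ?_
          filter_upwards [ae_unif01_mem] with y hy
          exact measure_between_lt_le hs hx hy
    _ ≤ _ := lintegral_pow_abs_le hs hx

lemma lintegral_root_between_lt_le {n d s : ℕ} (hs : 1 ≤ s) {x : ℝ}
    (hx : x ∈ Set.Icc (0 : ℝ) 1) (i : Fin d) :
    ∫⁻ S, (Measure.pi fun _ : Fin d => unif01) {r | between S x (r i) < s}
      ∂(Measure.pi fun _ : Fin n => unif01) ≤ ENNReal.ofReal (8 * s / (n + 1)) := by
  refine le_trans (le_of_eq (lintegral_congr fun S => ?_)) (lintegral_unif01_between_lt_le hs hx)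
  exact (measurePreserving_eval (fun _ : Fin d => unif01) i).measure_preimage
    (measurableSet_between_lt measurable_const measurable_const measurable_id s).nullMeasurableSet

lemma map_pair_pi_unif01 {d : ℕ} {i j : Fin d} (hij : i ≠ j) :
    (Measure.pi fun _ : Fin d => unif01).map (fun r => (r i, r j)) = unif01.prod unif01 := by
  have h := (iIndepFun_pi (μ := fun _ : Fin d => unif01) (X := fun _ => id)
    fun _ => aemeasurable_id).indepFun hij
  have h2 := (indepFun_iff_map_prod_eq_prod_map_map (measurable_pi_apply i).aemeasurable
    (measurable_pi_apply j).aemeasurable).1 h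
  have hi := (measurePreserving_eval (fun _ : Fin d => unif01) i).map_eq
  have hj := (measurePreserving_eval (fun _ : Fin d => unif01) j).map_eq
  refine h2.trans ?_
  exact congrArg₂ _ hi hj

lemma lintegral_pair_between_lt_le {n d s : ℕ} (hs : 1 ≤ s) {i j : Fin d} (hij : i ≠ j) :
    ∫⁻ S, (Measure.pi fun _ : Fin d => unif01) {r | between S (r i) (r j) < s}
      ∂(Measure.pi fun _ : Fin n => unif01) ≤ ENNReal.ofReal (8 * s / (n + 1)) := by
  have h1 : ∀ S : Fin n → ℝ, (Measure.pi fun _ : Fin d => unif01) {r | between S (r i) (r j) < s}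
      = ∫⁻ x, unif01 {y | between S x y < s} ∂unif01 := by
    intro S
    have hm : MeasurableSet {p : ℝ × ℝ | between S p.1 p.2 < s} :=
      measurableSet_between_lt measurable_const measurable_fst measurable_snd s
    have := Measure.map_apply (μ := Measure.pi fun _ : Fin d => unif01)
      (f := fun r => (r i, r j)) (by fun_prop) hm
    rw [map_pair_pi_unif01 hij, Measure.prod_apply hm] at this
    exact this.symm
  simp_rw [h1]
  rw [lintegral_lintegral_swap]
  · calc _ ≤ ∫⁻ _, ENNReal.ofReal (8 * s / (n + 1)) ∂unif01 := by
          refine lintegral_mono_ae ?_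
          filter_upwards [ae_unif01_mem] with x hx
          exact lintegral_unif01_between_lt_le hs hx
      _ = _ := by simp
  · have hm : MeasurableSet {p : ((Fin n → ℝ) × ℝ) × ℝ | between p.1.1 p.1.2 p.2 < s} :=
      measurableSet_between_lt (by fun_prop) (by fun_prop) (by fun_prop) s
    exact (measurable_measure_prodMk_left hm).aemeasurable

/-! ### Separation of the roots by the sample -/

/-- The sample has at least `s` points between any two of `0`, `1` and the roots, except possibly
between `0` and `1`. -/
def Separates {n d : ℕ} (s : ℕ) (S : Fin n → ℝ) (r : Fin d → ℝ) : Prop :=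
  (∀ i j, i ≠ j → s ≤ between S (r i) (r j)) ∧
    ∀ i, s ≤ between S 0 (r i) ∧ s ≤ between S 1 (r i)

lemma measurableSet_not_separates {n d s : ℕ} :
    MeasurableSet {p : (Fin n → ℝ) × (Fin d → ℝ) | ¬ Separates s p.1 p.2} := by
  have : {p : (Fin n → ℝ) × (Fin d → ℝ) | ¬ Separates s p.1 p.2} =
      (⋃ i : Fin d, ⋃ j : Fin d, ⋃ _ : i ≠ j, {p | between p.1 (p.2 i) (p.2 j) < s}) ∪
      ⋃ i : Fin d, ({p | between p.1 0 (p.2 i) < s} ∪ {p | between p.1 1 (p.2 i) < s}) := by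
    ext p
    simp only [Separates, Set.mem_ofPred_eq, Set.mem_union, Set.mem_iUnion, not_and_or, not_forall,
      not_le, exists_prop]
  rw [this]
  refine MeasurableSet.union ?_ ?_
  · exact .iUnion fun i => .iUnion fun j => .iUnion fun _ =>
      measurableSet_between_lt (by fun_prop) (by fun_prop) (by fun_prop) s
  · exact .iUnion fun i => .union
      (measurableSet_between_lt (by fun_prop) (by fun_prop) (by fun_prop) s)
      (measurableSet_between_lt (by fun_prop) (by fun_prop) (by fun_prop) s)

/-- Union bound over at most `d²` ordered pairs of roots and `2 d` pairs of a root and an endpoint,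
each costing `8 s / (n + 1)`; finally `d² + 2 d ≤ 3 d²`. -/
lemma lintegral_not_separates_le {n d s : ℕ} (hs : 1 ≤ s) :
    ∫⁻ S, (Measure.pi fun _ : Fin d => unif01) {r | ¬ Separates s S r}
      ∂(Measure.pi fun _ : Fin n => unif01) ≤
      ENNReal.ofReal (24 * (d : ℝ) ^ 2 * s / (n + 1)) := by
  set B := ENNReal.ofReal (8 * s / (n + 1))
  have hmS : ∀ (u v : (Fin d → ℝ) → ℝ), Measurable u → Measurable v →
      Measurable fun S : Fin n → ℝ => (Measure.pi fun _ : Fin d => unif01)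
        {r | between S (u r) (v r) < s} := fun u v hu hv =>
    measurable_measure_prodMk_left (s := {p : (Fin n → ℝ) × (Fin d → ℝ) |
      between p.1 (u p.2) (v p.2) < s}) (measurableSet_between_lt measurable_fst
        (hu.comp measurable_snd) (hv.comp measurable_snd) s)
  have hpt : ∀ S : Fin n → ℝ, (Measure.pi fun _ : Fin d => unif01) {r | ¬ Separates s S r} ≤
      (∑ i : Fin d, ∑ j ∈ Finset.univ.filter (fun j => i ≠ j),
        (Measure.pi fun _ : Fin d => unif01) {r | between S (r i) (r j) < s}) +
      ((∑ i : Fin d, (Measure.pi fun _ : Fin d => unif01) {r | between S 0 (r i) < s}) +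
      ∑ i : Fin d, (Measure.pi fun _ : Fin d => unif01) {r | between S 1 (r i) < s}) := by
    intro S
    refine (measure_mono (t := (⋃ i ∈ Finset.univ, ⋃ j ∈ Finset.univ.filter (fun j : Fin d => i ≠ j),
      {r : Fin d → ℝ | between S (r i) (r j) < s}) ∪
        ((⋃ i ∈ Finset.univ, {r : Fin d → ℝ | between S 0 (r i) < s}) ∪
          ⋃ i ∈ Finset.univ, {r : Fin d → ℝ | between S 1 (r i) < s})) ?_).trans ?_
    · intro r hr
      simp only [Separates, Set.mem_ofPred_eq, Set.mem_union, Set.mem_iUnion, not_and_or,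
        not_forall, not_le, exists_prop, Finset.mem_filter, Finset.mem_univ, true_and] at hr ⊢
      rcases hr with h | ⟨i, h | h⟩
      · exact Or.inl h
      · exact Or.inr (Or.inl ⟨i, h⟩)
      · exact Or.inr (Or.inr ⟨i, h⟩)
    · refine (measure_union_le _ _).trans (add_le_add ?_ ((measure_union_le _ _).trans
        (add_le_add (measure_biUnion_finset_le _ _) (measure_biUnion_finset_le _ _))))
      exact (measure_biUnion_finset_le _ _).trans
        (Finset.sum_le_sum fun i _ => measure_biUnion_finset_le _ _)
  calc _ ≤ _ := lintegral_mono hpt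
    _ = (∑ i : Fin d, ∑ j ∈ Finset.univ.filter (fun j => i ≠ j),
        ∫⁻ S, (Measure.pi fun _ : Fin d => unif01) {r | between S (r i) (r j) < s}
          ∂(Measure.pi fun _ : Fin n => unif01)) +
      ((∑ i : Fin d, ∫⁻ S, (Measure.pi fun _ : Fin d => unif01) {r | between S 0 (r i) < s}
          ∂(Measure.pi fun _ : Fin n => unif01)) +
      ∑ i : Fin d, ∫⁻ S, (Measure.pi fun _ : Fin d => unif01) {r | between S 1 (r i) < s}
          ∂(Measure.pi fun _ : Fin n => unif01)) := by
        have h1 : ∀ i j : Fin d, Measurable fun S : Fin n → ℝ =>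
          (Measure.pi fun _ : Fin d => unif01) {r | between S (r i) (r j) < s} :=
          fun i j => hmS _ _ (measurable_pi_apply i) (measurable_pi_apply j)
        have h2 : ∀ (x : ℝ) (i : Fin d), Measurable fun S : Fin n → ℝ =>
          (Measure.pi fun _ : Fin d => unif01) {r | between S x (r i) < s} :=
          fun x i => hmS _ _ measurable_const (measurable_pi_apply i)
        rw [lintegral_add_left, lintegral_add_left, lintegral_finsetSum, lintegral_finsetSum,
          lintegral_finsetSum]
        · congr 1
          refine Finset.sum_congr rfl fun i _ => ?_
          exact lintegral_finsetSum _ fun j _ => h1 i j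
        · exact fun i _ => h2 1 i
        · exact fun i _ => h2 0 i
        · exact fun i _ => Finset.measurable_fun_sum _ fun j _ => h1 i j
        · exact Finset.measurable_fun_sum _ fun i _ => h2 0 i
        · exact Finset.measurable_fun_sum _ fun i _ => Finset.measurable_fun_sum _ fun j _ => h1 i j
    _ ≤ (∑ i : Fin d, ∑ j : Fin d, B) + ((∑ i : Fin d, B) + ∑ i : Fin d, B) := by
        refine add_le_add (Finset.sum_le_sum fun i _ => ?_) (add_le_add
          (Finset.sum_le_sum fun i _ => lintegral_root_between_lt_le hs (by simp) i)
          (Finset.sum_le_sum fun i _ => lintegral_root_between_lt_le hs (by simp) i))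
        refine (Finset.sum_le_sum fun j hj => lintegral_pair_between_lt_le hs
          (Finset.mem_filter.1 hj).2).trans (Finset.sum_le_sum_of_subset (Finset.filter_subset _ _))
    _ = ((d * d + 2 * d : ℕ) : ℝ≥0∞) * B := by
        simp only [Finset.sum_const, Finset.card_univ, Fintype.card_fin, nsmul_eq_mul]
        push_cast
        ring
    _ ≤ ((3 * d ^ 2 : ℕ) : ℝ≥0∞) * B := by
        gcongr
        nlinarith [Nat.le_self_pow two_ne_zero d]
    _ = _ := by
        rw [← ENNReal.ofReal_natCast, ← ENNReal.ofReal_mul (by positivity)]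
        congr 1
        push_cast
        ring

lemma ae_roots_generic {n d : ℕ} (S : Fin n → ℝ) :
    ∀ᵐ r ∂(Measure.pi fun _ : Fin d => unif01),
      (∀ i, r i ∈ Set.Ioo (0 : ℝ) 1) ∧ ∀ i k, r i ≠ S k := by
  have h : ∀ᵐ x ∂unif01, x ∈ Set.Ioo (0 : ℝ) 1 ∧ ∀ k, x ≠ S k := by
    have h1 : ∀ y, ∀ᵐ x ∂unif01, x ≠ y := fun y => by
      simp [ae_iff]
    filter_upwards [ae_unif01_mem, h1 0, h1 1, ae_all_iff.2 fun k => h1 (S k)] with x hx h0 h1 hS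
    exact ⟨⟨lt_of_le_of_ne hx.1 h0.symm, lt_of_le_of_ne hx.2 h1⟩, hS⟩
  have h2 := ae_all_iff.2 fun i : Fin d =>
    (measurePreserving_eval (fun _ : Fin d => unif01) i).quasiMeasurePreserving.ae h
  filter_upwards [h2] with r hr
  exact ⟨fun i => (hr i).1, fun i => (hr i).2⟩

lemma measurable_comp_sample {n : ℕ} (S : Fin n → ℝ) :
    Measurable fun h : ℝ → Bool => h ∘ S :=
  measurable_pi_lambda _ fun i => measurable_pi_apply (S i)

lemma measurable_rootsPTF_comp {n d : ℕ} (a : ℝ) (S : Fin n → ℝ) :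
    Measurable fun r : Fin d → ℝ => rootsPTF a r ∘ S :=
  (measurable_comp_sample S).comp (measurable_rootsPTF a)

/-- The integrand depends on `h` only through finitely many labels, so it is measurable for
arbitrary `F` and the law can be pulled back to the roots. -/
lemma lintegral_uniformRoots {n d : ℕ} (a : ℝ) (S : Fin n → ℝ) (F : (Fin n → Bool) → ℝ≥0∞) :
    ∫⁻ h, F (h ∘ S) ∂(uniformRoots a d) =
      ∫⁻ r, F (rootsPTF a r ∘ S) ∂(Measure.pi fun _ : Fin d => unif01) := by
  rw [uniformRoots]
  exact lintegral_map (f := fun h => F (h ∘ S)) ((Measurable.of_discrete (f := F)).comp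
    (measurable_comp_sample S)) (measurable_rootsPTF a)

lemma ae_sample_injective (n : ℕ) :
    ∀ᵐ S ∂(Measure.pi fun _ : Fin n => unif01), Function.Injective S := by
  have h : ∀ i j : Fin n, i ≠ j → ∀ᵐ S ∂(Measure.pi fun _ : Fin n => unif01), S i ≠ S j := by
    intro i j hij
    have hm : MeasurableSet {p : ℝ × ℝ | p.1 = p.2} :=
      measurableSet_eq_fun measurable_fst measurable_snd
    have := Measure.map_apply (μ := Measure.pi fun _ : Fin n => unif01)
      (f := fun r => (r i, r j)) (by fun_prop) hm
    rw [map_pair_pi_unif01 hij, Measure.prod_apply hm] at this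
    have h0 : ∀ x : ℝ, unif01 (Prod.mk x ⁻¹' {p : ℝ × ℝ | p.1 = p.2}) = 0 := by
      intro x
      refine measure_mono_null (t := {x}) ?_ (measure_singleton x)
      intro y hy
      exact (show x = y from hy).symm
    simp_rw [h0, lintegral_zero] at this
    rw [ae_iff]
    simp only [ne_eq, not_not]
    exact this.symm
  have h2 := ae_all_iff.2 fun i => ae_all_iff.2 fun j => Filter.eventually_all.2 (h i j)
  filter_upwards [h2] with S hS i j hij
  by_contra hne
  exact hS i j hne hij

/-! ### Lower bound: few queries confine the roots to a small set -/

/-- Every one of the `M` equal cells of the unit interval contains a sample point. -/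
def HitsCells {n : ℕ} (M : ℕ) (S : Fin n → ℝ) : Prop :=
  ∀ c < M, 1 ≤ between S ((c : ℝ) / M) (((c + 1 : ℕ) : ℝ) / M)

lemma not_hitsCells_eq {n M : ℕ} : {S : Fin n → ℝ | ¬ HitsCells M S} =
    ⋃ c ∈ Finset.range M, {S | between S ((c : ℝ) / M) (((c + 1 : ℕ) : ℝ) / M) < 1} := by
  ext S
  simp only [HitsCells, Set.mem_ofPred_eq, Set.mem_iUnion, not_forall, not_le, exists_prop,
    Finset.mem_range]

lemma measurableSet_not_hitsCells {n M : ℕ} :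
    MeasurableSet {S : Fin n → ℝ | ¬ HitsCells M S} := by
  rw [not_hitsCells_eq]
  exact Finset.measurableSet_biUnion _ fun c _ =>
    measurableSet_between_lt measurable_id measurable_const measurable_const 1

lemma measure_not_hitsCells_le {n M : ℕ} (hM : 0 < M) :
    (Measure.pi fun _ : Fin n => unif01) {S | ¬ HitsCells M S} ≤
      ENNReal.ofReal (M * (2 * (1 - 1 / (2 * M)) ^ n)) := by
  have hM' : (0 : ℝ) < M := by exact_mod_cast hM
  rw [not_hitsCells_eq]
  refine (measure_biUnion_finset_le _ _).trans ?_
  calc _ ≤ ∑ c ∈ Finset.range M, ENNReal.ofReal (2 * (1 - 1 / (2 * M)) ^ n) := by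
        refine Finset.sum_le_sum fun c hc => ?_
        have hc' : ((c + 1 : ℕ) : ℝ) ≤ M := by exact_mod_cast Finset.mem_range.1 hc
        have h1 : (c : ℝ) / M ∈ Set.Icc (0 : ℝ) 1 := by
          refine ⟨by positivity, (div_le_one hM').2 ?_⟩
          push_cast at hc'
          linarith
        have h2 : ((c + 1 : ℕ) : ℝ) / M ∈ Set.Icc (0 : ℝ) 1 :=
          ⟨by positivity, (div_le_one hM').2 hc'⟩
        refine (measure_between_lt_le le_rfl h1 h2).trans (le_of_eq ?_)
        have h3 : |(c : ℝ) / M - ((c + 1 : ℕ) : ℝ) / M| = 1 / M := by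
          push_cast
          rw [← sub_div, show (c : ℝ) - (c + 1) = -1 by ring, neg_div, abs_neg,
            abs_of_pos (by positivity)]
        rw [h3]
        congr 4
        push_cast
        field_simp
    _ = _ := by
        rw [Finset.sum_const, Finset.card_range, nsmul_eq_mul, ← ENNReal.ofReal_natCast,
          ← ENNReal.ofReal_mul hM'.le]

lemma abs_sub_le_of_hitsCells {n M : ℕ} (hM : 0 < M) {S : Fin n → ℝ} (hS : HitsCells M S)
    {u v : ℝ} (hu : u ∈ Set.Ioo (0 : ℝ) 1) (hv : v ∈ Set.Ioo (0 : ℝ) 1)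
    (huv : ∀ i, S i ∉ Set.uIoo u v) : |u - v| ≤ 2 / M := by
  have hM' : (0 : ℝ) < M := by exact_mod_cast hM
  wlog h : u ≤ v generalizing u v
  · rw [abs_sub_comm]
    refine this hv hu (fun i => ?_) (le_of_not_ge h)
    rw [Set.uIoo_comm]
    exact huv i
  rw [abs_of_nonpos (sub_nonpos.2 h)]
  by_contra! hlt
  -- `c / M` is the first cell boundary to the right of `u`. If `v - u > 2 / M`, the whole cell
  -- starting there lies between `u` and `v`, and it contains a sample point.
  set c := ⌊u * M⌋₊ + 1 with hc
  have h1 : u * M < c := by rw [hc]; push_cast; exact Nat.lt_floor_add_one _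
  have h2 : (c : ℝ) ≤ u * M + 1 := by
    rw [hc]; push_cast
    linarith [Nat.floor_le (mul_nonneg hu.1.le hM'.le)]
  have h3 : 2 < (v - u) * M := by
    rw [div_lt_iff₀ hM'] at hlt
    linarith
  have h4 : ((c + 1 : ℕ) : ℝ) < v * M := by push_cast; linarith
  have h5 : v * M < M := by nlinarith [hv.2]
  have h6 : c < M := by
    have : ((c + 1 : ℕ) : ℝ) < M := h4.trans h5
    have := Nat.cast_lt.1 this
    omega
  obtain ⟨i, hi⟩ := one_le_between.1 (hS c h6)
  rw [Set.uIoo_of_le (by gcongr; omega)] at hi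
  refine huv i ?_
  rw [Set.uIoo_of_le h]
  refine ⟨lt_trans ?_ hi.1, hi.2.trans ?_⟩
  · rwa [lt_div_iff₀ hM']
  · rwa [div_lt_iff₀ hM']

lemma lt_iff_lt_of_notMem_uIoo {u v x : ℝ} (hu : u ≠ x) (hv : v ≠ x) (h : x ∉ Set.uIoo u v) :
    u < x ↔ v < x := by
  constructor <;> intro h' <;> by_contra hle <;> refine h ⟨?_, ?_⟩ <;> simp only [inf_lt_iff,
    lt_sup_iff] <;> grind

/-- On a sample that hits all cells, separated roots with prescribed labels are confined to `d!`
small boxes. -/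
lemma measure_label_eq_le {n d M : ℕ} {a : ℝ} (ha : a ≠ 0) (hM : 0 < M) {S : Fin n → ℝ}
    (hS : HitsCells M S) (l : Fin n → Bool) :
    (Measure.pi fun _ : Fin d => unif01) {r | Separates 1 S r ∧ rootsPTF a r ∘ S = l} ≤
      ENNReal.ofReal (d.factorial * (4 / M) ^ d) := by
  set G : Set (Fin d → ℝ) := {r | (∀ i, r i ∈ Set.Ioo (0 : ℝ) 1) ∧ ∀ i k, r i ≠ S k} with hG
  have hle : (Measure.pi fun _ : Fin d => unif01) {r | Separates 1 S r ∧ rootsPTF a r ∘ S = l} ≤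
      (Measure.pi fun _ : Fin d => unif01)
        ({r | Separates 1 S r ∧ rootsPTF a r ∘ S = l} ∩ G) := by
    refine measure_mono_ae ?_
    filter_upwards [ae_roots_generic (d := d) S] with r hr h
    exact ⟨h, hr⟩
  refine hle.trans ?_
  rcases Set.eq_empty_or_nonempty ({r | Separates 1 S r ∧ rootsPTF a r ∘ S = l} ∩ G) with h | h
  · rw [h, measure_empty]
    exact zero_le
  obtain ⟨r₀, ⟨-, hl₀⟩, hG₀⟩ := h
  have hsub : ({r | Separates 1 S r ∧ rootsPTF a r ∘ S = l} ∩ G) ⊆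
      ⋃ σ ∈ (Finset.univ : Finset (Equiv.Perm (Fin d))),
        Set.pi Set.univ fun i => Set.Icc (r₀ (σ i) - 2 / M) (r₀ (σ i) + 2 / M) := by
    rintro r ⟨⟨hsep, hl⟩, hr⟩
    have hgap := exists_root_same_gap ha hr.1 hG₀.1 hr.2 hG₀.2
      (fun i => congrFun (hl.trans hl₀.symm) i) (fun i j hij => one_le_between.1 (hsep.1 i j hij))
    choose f hf using hgap
    -- Two roots sharing a gap with the same reference root would share a gap with each other,
    -- against separation. So `f` is a permutation, whence the `d!` boxes of side `4 / M`.
    have hinj : Function.Injective f := by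
      intro i j hij
      by_contra hne
      obtain ⟨k, hk⟩ := one_le_between.1 (hsep.1 i j hne)
      have h1 := hf i k
      have h2 := hf j k
      rw [← hij] at h2
      have h3 := (lt_iff_lt_of_notMem_uIoo (hr.2 i k) (hG₀.2 (f i) k) h1).trans
        (lt_iff_lt_of_notMem_uIoo (hr.2 j k) (hG₀.2 (f i) k) h2).symm
      rcases lt_or_gt_of_ne (hr.2 i k) with h4 | h4
      · exact absurd hk.2 (max_lt h4 (h3.1 h4)).not_gt
      · refine absurd hk.1 (lt_min h4 (lt_of_le_of_ne (not_lt.1 fun h => ?_) (hr.2 j k).symm)).not_gt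
        exact absurd h4 (h3.2 h).not_gt
    set σ : Equiv.Perm (Fin d) := Equiv.ofBijective f hinj.bijective_of_finite with hσ
    simp only [Set.mem_iUnion]
    refine ⟨σ, Finset.mem_univ _, fun i _ => ?_⟩
    have : -(2 / (M : ℝ)) ≤ r i - r₀ (σ i) ∧ r i - r₀ (σ i) ≤ 2 / M :=
      abs_le.1 (abs_sub_le_of_hitsCells hM hS (hr.1 i) (hG₀.1 (f i)) (hf i))
    exact ⟨by linarith [this.1], by linarith [this.2]⟩
  refine (measure_mono hsub).trans ((measure_biUnion_finset_le _ _).trans ?_)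
  calc _ ≤ ∑ _σ : Equiv.Perm (Fin d), ENNReal.ofReal ((4 / M) ^ d) := by
        refine Finset.sum_le_sum fun σ _ => ?_
        rw [Measure.pi_pi, ENNReal.ofReal_pow (by positivity)]
        refine (Finset.prod_le_prod' (g := fun _ => ENNReal.ofReal (4 / M)) fun i _ => ?_).trans
          (by simp)
        refine (Measure.restrict_apply_le _ _).trans (le_of_eq ?_)
        rw [Real.volume_Icc]
        congr 1
        ring
    _ = _ := by
        rw [Finset.sum_const, Finset.card_univ, Fintype.card_perm, Fintype.card_fin, nsmul_eq_mul,
          ← ENNReal.ofReal_natCast, ← ENNReal.ofReal_mul (by positivity)]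

/-- Union bound over the at most `2 ^ k` labelings that a correct tree identifies with `k` queries.
-/
lemma measure_queries_le {n d M k : ℕ} {a : ℝ} (ha : a ≠ 0) (hM : 0 < M) {S : Fin n → ℝ}
    (hS : HitsCells M S) {t : QueryTree n}
    (ht : ∀ r : Fin d → ℝ, t.run (rootsPTF a r ∘ S) = rootsPTF a r ∘ S) :
    (Measure.pi fun _ : Fin d => unif01)
      {r | Separates 1 S r ∧ t.queries (rootsPTF a r ∘ S) ≤ k} ≤
      ENNReal.ofReal (2 ^ k * (d.factorial * (4 / M) ^ d)) := by
  set T := Finset.univ.filter fun l : Fin n → Bool => t.run l = l ∧ t.queries l ≤ k with hT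
  have hsub : {r : Fin d → ℝ | Separates 1 S r ∧ t.queries (rootsPTF a r ∘ S) ≤ k} ⊆
      ⋃ l ∈ T, {r | Separates 1 S r ∧ rootsPTF a r ∘ S = l} := by
    rintro r ⟨h1, h2⟩
    simp only [Set.mem_iUnion]
    exact ⟨rootsPTF a r ∘ S, Finset.mem_filter.2 ⟨Finset.mem_univ _, ht r, h2⟩, h1, rfl⟩
  refine (measure_mono hsub).trans ((measure_biUnion_finset_le _ _).trans ?_)
  refine (Finset.sum_le_sum fun l _ => measure_label_eq_le ha hM hS l).trans ?_
  rw [Finset.sum_const, nsmul_eq_mul, ENNReal.ofReal_mul (p := (2 : ℝ) ^ k) (by positivity)]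
  refine mul_le_mul' ?_ le_rfl
  rw [ENNReal.ofReal_pow zero_le_two, ENNReal.ofReal_ofNat]
  exact_mod_cast t.card_run_eq_le k

/-- A correct strategy either makes more than `k` queries, or the sample does not separate the
roots, or the roots lie in a small set. -/
lemma le_lintegral_queries {n d M : ℕ} (k : ℕ) {a : ℝ} (ha : a ≠ 0) (hM : 0 < M) {S : Fin n → ℝ}
    (hS : HitsCells M S) {t : QueryTree n}
    (ht : ∀ r : Fin d → ℝ, t.run (rootsPTF a r ∘ S) = rootsPTF a r ∘ S) :
    (k : ℝ≥0∞) ≤ k * (ENNReal.ofReal (2 ^ k * (d.factorial * (4 / M) ^ d)) +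
      (Measure.pi fun _ : Fin d => unif01) {r | ¬ Separates 1 S r}) +
      ∫⁻ r, (t.queries (rootsPTF a r ∘ S) : ℝ≥0∞) ∂(Measure.pi fun _ : Fin d => unif01) := by
  set ν := Measure.pi fun _ : Fin d => unif01
  have h1 : 1 ≤ ν {r | Separates 1 S r ∧ t.queries (rootsPTF a r ∘ S) ≤ k} +
      ν {r | ¬ Separates 1 S r} + ν {r | (k : ℝ≥0∞) ≤ (t.queries (rootsPTF a r ∘ S) : ℝ≥0∞)} := by
    rw [← measure_univ (μ := ν)]
    refine (measure_mono fun r _ => ?_).trans ((measure_union_le _ _).trans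
      (add_le_add_left (measure_union_le _ _) _))
    by_cases hs : Separates 1 S r
    · by_cases hq : t.queries (rootsPTF a r ∘ S) ≤ k
      · exact Or.inl (Or.inl ⟨hs, hq⟩)
      · refine Or.inr ?_
        simp only [Set.mem_ofPred_eq]
        exact_mod_cast (not_le.1 hq).le
    · exact Or.inl (Or.inr hs)
  have hm : Measurable fun r : Fin d → ℝ => (t.queries (rootsPTF a r ∘ S) : ℝ≥0∞) :=
    (Measurable.of_discrete (f := fun l => (t.queries l : ℝ≥0∞))).comp
      (measurable_rootsPTF_comp a S)
  calc (k : ℝ≥0∞) = k * 1 := (mul_one _).symm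
    _ ≤ k * (ν {r | Separates 1 S r ∧ t.queries (rootsPTF a r ∘ S) ≤ k} +
      ν {r | ¬ Separates 1 S r} + ν {r | (k : ℝ≥0∞) ≤ (t.queries (rootsPTF a r ∘ S) : ℝ≥0∞)}) := by
        gcongr
    _ ≤ _ := by
        rw [mul_add]
        refine add_le_add ?_ (mul_meas_ge_le_lintegral hm _)
        gcongr
        exact measure_queries_le ha hM hS ht

/-- Joint measurability comes from the finiteness of the set of labelings and the discrete σ-algebra
on trees. -/
lemma lintegral_lintegral_queries_comm {n d : ℕ} (a : ℝ) (S : Fin n → ℝ)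
    (α : Measure (QueryTree n)) [SFinite α] :
    ∫⁻ r, ∫⁻ t, (t.queries (rootsPTF a r ∘ S) : ℝ≥0∞) ∂α ∂(Measure.pi fun _ : Fin d => unif01) =
    ∫⁻ t, ∫⁻ r, (t.queries (rootsPTF a r ∘ S) : ℝ≥0∞) ∂(Measure.pi fun _ : Fin d => unif01) ∂α := by
  refine lintegral_lintegral_swap (Measurable.aemeasurable ?_)
  have h : Measurable fun p : (Fin n → Bool) × QueryTree n => (p.2.queries p.1 : ℝ≥0∞) :=
    measurable_from_prod_countable_right fun l => measurable_from_top
  exact h.comp (((measurable_rootsPTF_comp a S).comp measurable_fst).prodMk measurable_snd)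

/-- Yao's principle: once the learner's randomness is integrated last, the bound for a fixed correct
tree applies to almost every tree drawn. Bad samples enter only through their probability. -/
lemma le_expected_queries {n d M : ℕ} (k : ℕ) {a : ℝ} (ha : a ≠ 0) (hM : 0 < M) {q : ℕ → ℝ≥0}
    (hq : PerfectlyLearnable unif01 (uniformRoots a d) (PTF d) q) :
    (k : ℝ≥0∞) ≤ k * (ENNReal.ofReal (2 ^ k * (d.factorial * (4 / M) ^ d)) +
      (ENNReal.ofReal (24 * (d : ℝ) ^ 2 / (n + 1)) +
        ENNReal.ofReal (M * (2 * (1 - 1 / (2 * M)) ^ n)))) + q n := by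
  obtain ⟨A, hA, hcor, hcost⟩ := hq
  have := hA n
  set μ := Measure.pi fun _ : Fin n => unif01
  set ν := Measure.pi fun _ : Fin d => unif01
  set β := ENNReal.ofReal (2 ^ k * (d.factorial * (4 / (M : ℝ)) ^ d)) with hβ
  set B : Set (Fin n → ℝ) := {S | ¬ HitsCells M S} with hB
  have hpt : ∀ᵐ S ∂μ, (k : ℝ≥0∞) ≤ k * (β + (ν {r | ¬ Separates 1 S r} + B.indicator 1 S)) +
      ∫⁻ h, ∫⁻ t, (t.queries (h ∘ S) : ℝ≥0∞) ∂(A n S) ∂(uniformRoots a d) := by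
    filter_upwards [ae_sample_injective n] with S hS
    by_cases hd : HitsCells M S
    · have hc : ∀ᵐ t ∂(A n S), ∀ r : Fin d → ℝ, t.run (rootsPTF a r ∘ S) = rootsPTF a r ∘ S := by
        -- The null set of failing trees depends on the hypothesis, and there are uncountably many
        -- root tuples. They produce only finitely many labelings, so one null set suffices.
        have h1 : ∀ l : Fin n → Bool, ∀ᵐ t ∂(A n S),
            (∃ r : Fin d → ℝ, rootsPTF a r ∘ S = l) → t.run l = l := by
          intro l
          by_cases hl : ∃ r : Fin d → ℝ, rootsPTF a r ∘ S = l
          · obtain ⟨r, rfl⟩ := hl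
            filter_upwards [hcor n S hS _ (rootsPTF_mem_PTF a r)] with t ht _ using ht
          · exact Filter.Eventually.of_forall fun t h => absurd h hl
        filter_upwards [ae_all_iff.2 h1] with t ht r using ht _ ⟨r, rfl⟩
      rw [lintegral_uniformRoots a S fun l => ∫⁻ t, (t.queries l : ℝ≥0∞) ∂(A n S),
        lintegral_lintegral_queries_comm]
      calc (k : ℝ≥0∞) = ∫⁻ _t, (k : ℝ≥0∞) ∂(A n S) := by simp
        _ ≤ ∫⁻ t, (k * (β + ν {r | ¬ Separates 1 S r}) +
            ∫⁻ r, (t.queries (rootsPTF a r ∘ S) : ℝ≥0∞) ∂ν) ∂(A n S) := by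
              refine lintegral_mono_ae ?_
              filter_upwards [hc] with t ht
              exact le_lintegral_queries k ha hM hd ht
        _ ≤ _ := by
              rw [lintegral_add_left measurable_const]
              refine add_le_add_left ?_ _
              rw [lintegral_const, measure_univ, mul_one]
              gcongr
              exact le_self_add
    -- On a sample missing a cell the indicator equals `1` and the inequality is trivial.
    · have h1 : B.indicator (1 : (Fin n → ℝ) → ℝ≥0∞) S = 1 := Set.indicator_of_mem hd _
      rw [h1]
      calc (k : ℝ≥0∞) = k * 1 := (mul_one _).symm
        _ ≤ k * (β + (ν {r | ¬ Separates 1 S r} + 1)) := by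
            gcongr
            exact le_add_self.trans le_add_self
        _ ≤ _ := le_self_add
  have hmν : Measurable fun S : Fin n → ℝ => ν {r : Fin d → ℝ | ¬ Separates 1 S r} :=
    measurable_measure_prodMk_left measurableSet_not_separates
  have hmB : Measurable (B.indicator (1 : (Fin n → ℝ) → ℝ≥0∞)) :=
    measurable_one.indicator measurableSet_not_hitsCells
  have hmsum : Measurable fun S : Fin n → ℝ =>
      β + (ν {r | ¬ Separates 1 S r} + B.indicator 1 S) :=
    measurable_const.add (hmν.add hmB)
  calc (k : ℝ≥0∞) = ∫⁻ _S, (k : ℝ≥0∞) ∂μ := by simp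
    _ ≤ _ := lintegral_mono_ae hpt
    _ = k * (β + (∫⁻ S, ν {r | ¬ Separates 1 S r} ∂μ + μ B)) +
      ∫⁻ S, ∫⁻ h, ∫⁻ t, (t.queries (h ∘ S) : ℝ≥0∞) ∂(A n S) ∂(uniformRoots a d) ∂μ := by
        rw [lintegral_add_left (hmsum.const_mul _), lintegral_const_mul _ hmsum,
          lintegral_add_left measurable_const, lintegral_add_left hmν, lintegral_const,
          measure_univ, mul_one, lintegral_indicator_one measurableSet_not_hitsCells]
    _ ≤ _ := by
        refine add_le_add ?_ (hcost n)
        gcongr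
        · simpa using lintegral_not_separates_le (n := n) (d := d) le_rfl
        · exact measure_not_hitsCells_le hM

/-- With `y = 2 ^ γ`, `M = y ^ 6` and `n ≥ y ^ 8`, the power is at most `exp (-y² / 2)`. The fourth
Taylor term of the exponential bounds this by `384 / y ^ 8`, which leaves `768 / y²`. -/
lemma cells_mul_pow_le {γ n : ℕ} (hγ : 10 ≤ γ) (hn : 2 ^ (8 * γ) ≤ n) :
    ((2 ^ (6 * γ) : ℕ) : ℝ) * (2 * (1 - 1 / (2 * (2 ^ (6 * γ) : ℕ))) ^ n) ≤ 1 / 8 := by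
  set M : ℝ := ((2 ^ (6 * γ) : ℕ) : ℝ) with hM
  set y : ℝ := 2 ^ γ with hy
  have hy10 : (1024 : ℝ) ≤ y := by
    calc (1024 : ℝ) = 2 ^ 10 := by norm_num
      _ ≤ _ := pow_le_pow_right₀ one_le_two hγ
  have hMy : M = y ^ 6 := by rw [hM, hy, ← pow_mul, mul_comm γ]; push_cast; rfl
  have hny : y ^ 8 ≤ n := by
    rw [hy, ← pow_mul, mul_comm γ]; exact_mod_cast hn
  have hM1 : 1 ≤ M := by rw [hMy]; exact one_le_pow₀ (by linarith)
  have h1 : (1 - 1 / (2 * M)) ^ n ≤ Real.exp (-(1 / (2 * M))) ^ n := by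
    refine pow_le_pow_left₀ ?_ (Real.one_sub_le_exp_neg _) n
    have : 1 / (2 * M) ≤ 1 := by rw [div_le_one (by positivity)]; linarith
    linarith
  have h2 : Real.exp (-(1 / (2 * M))) ^ n ≤ Real.exp (-(y ^ 2 / 2)) := by
    rw [← Real.exp_nat_mul]
    refine Real.exp_le_exp.2 ?_
    have h3 : y ^ 2 / 2 = y ^ 8 * (1 / (2 * M)) := by rw [hMy]; field_simp
    rw [h3]
    have : y ^ 8 * (1 / (2 * M)) ≤ n * (1 / (2 * M)) := by gcongr
    linarith
  have h3 : (y ^ 2 / 2) ^ 4 / 24 ≤ Real.exp (y ^ 2 / 2) := by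
    have := Real.pow_div_factorial_le_exp (y ^ 2 / 2) (by positivity) 4
    simpa [Nat.factorial] using this
  have h4 : Real.exp (-(y ^ 2 / 2)) ≤ 384 / y ^ 8 := by
    rw [Real.exp_neg, inv_le_comm₀ (Real.exp_pos _) (by positivity)]
    refine le_trans (le_of_eq ?_) h3
    field_simp
    norm_num
  calc M * (2 * (1 - 1 / (2 * M)) ^ n) ≤ y ^ 6 * (2 * (384 / y ^ 8)) := by
        rw [← hMy]
        gcongr
        exact (h1.trans h2).trans h4
    _ = 768 / y ^ 2 := by field_simp; norm_num
    _ ≤ 1 / 8 := by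
        rw [div_le_div_iff₀ (by positivity) (by norm_num)]
        nlinarith

/-- Since `d! ≤ d ^ d`, the left side is at most `(4 d / y ^ 5) ^ d` with `y = 2 ^ γ`. -/
lemma two_pow_mul_factorial_mul_le {γ d : ℕ} (hd : 1 ≤ d) (h : d * 2 ^ 36 ≤ 2 ^ (4 * γ)) :
    (2 : ℝ) ^ (γ * d) * (d.factorial * (4 / (2 ^ (6 * γ) : ℕ)) ^ d) ≤ 1 / 8 := by
  set y : ℝ := 2 ^ γ with hy
  have hy1 : 1 ≤ y := one_le_pow₀ one_le_two
  have hfac : (d.factorial : ℝ) ≤ (d : ℝ) ^ d := by exact_mod_cast Nat.factorial_le_pow d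
  have hdy : (d : ℝ) * 2 ^ 36 ≤ y ^ 4 := by
    rw [hy, ← pow_mul, mul_comm γ]; exact_mod_cast h
  have hM : ((2 ^ (6 * γ) : ℕ) : ℝ) = y ^ 6 := by
    rw [hy, ← pow_mul, mul_comm γ]; push_cast; rfl
  calc (2 : ℝ) ^ (γ * d) * (d.factorial * (4 / (2 ^ (6 * γ) : ℕ)) ^ d)
      ≤ y ^ d * ((d : ℝ) ^ d * (4 / y ^ 6) ^ d) := by
        rw [hM, pow_mul]
        gcongr
    _ = (y * (d * (4 / y ^ 6))) ^ d := by rw [mul_pow, mul_pow]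
    _ ≤ (1 / 8) ^ d := by
        gcongr
        have : y * (d * (4 / y ^ 6)) = 4 * d / y ^ 5 := by field_simp
        rw [this, div_le_div_iff₀ (by positivity) (by norm_num)]
        have : y ^ 4 ≤ y ^ 5 := pow_le_pow_right₀ hy1 (by norm_num)
        have : (0 : ℝ) ≤ d := by positivity
        linarith
    _ ≤ 1 / 8 := pow_le_of_le_one (by norm_num) (by norm_num) (by omega)

theorem lower_bound {d : ℕ} (hd : 1 ≤ d) {a : ℝ} (ha : a ≠ 0) {q : ℕ → ℝ≥0}
    (hq : PerfectlyLearnable unif01 (uniformRoots a d) (PTF d) q) {n : ℕ}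
    (hn : (2 : ℝ) ^ 88 * (d : ℝ) ^ 2 ≤ n) : 1 / 32 * d * Real.log n ≤ q n := by
  have hn' : 2 ^ 88 * d ^ 2 ≤ n := by exact_mod_cast hn
  have hd2 : 1 ≤ d ^ 2 := Nat.one_le_pow _ _ hd
  have hn88 : 2 ^ 88 ≤ n := le_trans (by omega) hn'
  have hn0 : n ≠ 0 := by intro h; rw [h] at hn88; norm_num at hn88
  have hlog : 88 ≤ Nat.log 2 n := (Nat.le_log_iff_pow_le one_lt_two hn0).2 hn88
  -- Thus `2 ^ γ` is about `n ^ (1/8)`; below, `k = γ d` and `M = 2 ^ (6 γ)`. Each of the three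
  -- error probabilities is at most `1 / 8`, so `q n ≥ (5 / 8) γ d`, and `log n ≤ 16 γ` gives the
  -- constant `1 / 32`.
  set γ := Nat.log 2 n / 8 with hγ
  have hγ10 : 10 ≤ γ := by omega
  have hlow : 2 ^ (8 * γ) ≤ n :=
    (Nat.pow_le_pow_right two_pos (by omega)).trans (Nat.pow_log_le_self 2 hn0)
  have hupp : n < 2 ^ (8 * γ + 8) :=
    (Nat.lt_pow_succ_log_self one_lt_two n).trans_le (Nat.pow_le_pow_right two_pos (by omega))
  have hdγ : d * 2 ^ 36 ≤ 2 ^ (4 * γ) := by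
    refine le_of_lt (lt_of_pow_lt_pow_left₀ 2 (Nat.zero_le _) ?_)
    have h1 : (2 ^ (4 * γ)) ^ 2 * 2 ^ 8 = 2 ^ (8 * γ + 8) := by
      rw [← pow_mul, ← pow_add]; congr 1; ring
    have h2 := hn'.trans_lt hupp
    rw [← h1] at h2
    rw [mul_pow]
    omega
  have hmain := le_expected_queries (n := n) (M := 2 ^ (6 * γ)) (γ * d) ha (by positivity) hq
  set k := γ * d with hk
  have h1 := two_pow_mul_factorial_mul_le hd hdγ
  have h2 := cells_mul_pow_le hγ10 hlow
  have h3 : 24 * (d : ℝ) ^ 2 / (n + 1) ≤ 1 / 8 := by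
    rw [div_le_div_iff₀ (by positivity) (by norm_num)]
    nlinarith [sq_nonneg (d : ℝ)]
  have h4 : (k : ℝ≥0∞) ≤ ENNReal.ofReal (k * (1 / 8 + (1 / 8 + 1 / 8)) + q n) := by
    refine hmain.trans ?_
    rw [ENNReal.ofReal_add (by positivity) (by positivity),
      ENNReal.ofReal_mul (p := (k : ℝ)) (by positivity),
      ENNReal.ofReal_add (by norm_num) (by norm_num),
      ENNReal.ofReal_add (by norm_num) (by norm_num), ENNReal.ofReal_natCast,
      ENNReal.ofReal_coe_nnreal]
    gcongr
  rw [← ENNReal.ofReal_natCast, ENNReal.ofReal_le_ofReal_iff (by positivity)] at h4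
  have h5 : Real.log n ≤ 16 * γ := by
    have h6 : Real.log n ≤ Real.log (2 ^ (8 * γ + 8)) :=
      Real.log_le_log (by positivity) (by exact_mod_cast hupp.le)
    rw [Real.log_pow] at h6
    have h7 : (10 : ℝ) ≤ γ := by exact_mod_cast hγ10
    have h8 := Real.log_two_lt_d9
    push_cast at h6
    nlinarith
  have h6 : (k : ℝ) = γ * d := by rw [hk]; push_cast; ring
  have h7 : 1 / 32 * d * Real.log n ≤ 1 / 32 * d * (16 * γ) := by gcongr
  have h8 : (0 : ℝ) ≤ q n := (q n).2
  nlinarith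

/-! ### Upper bound: dyadic refinement on the sorted sample -/

/-- The learner must be a kernel, hence measurable in the sample. The sorting permutation is
characterized by finitely many order conditions, including that ties are broken by index. -/
lemma measurableSet_sort_eq {n : ℕ} (σ : Equiv.Perm (Fin n)) :
    MeasurableSet {S : Fin n → ℝ | Tuple.sort S = σ} := by
  have : {S : Fin n → ℝ | Tuple.sort S = σ} =
      (⋂ i, ⋂ j, ⋂ _ : i ≤ j, {S | S (σ i) ≤ S (σ j)}) ∩
        ⋂ i, ⋂ j, ⋂ _ : i < j, ⋂ _ : ¬ σ i < σ j, {S | S (σ i) ≠ S (σ j)} := by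
    ext S
    simp only [Set.mem_ofPred_eq, eq_comm (a := Tuple.sort S), Tuple.eq_sort_iff, Set.mem_inter_iff,
      Set.mem_iInter]
    refine and_congr Iff.rfl ?_
    refine forall_congr' fun i => forall_congr' fun j => forall_congr' fun _ => ?_
    exact not_imp_not.symm
  rw [this]
  refine MeasurableSet.inter ?_ ?_
  · exact .iInter fun i => .iInter fun j => .iInter fun _ =>
      measurableSet_le (measurable_pi_apply _) (measurable_pi_apply _)
  · exact .iInter fun i => .iInter fun j => .iInter fun _ => .iInter fun _ =>
      (measurableSet_eq_fun (measurable_pi_apply (σ i)) (measurable_pi_apply (σ j))).compl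

lemma measurable_comp_sort {n : ℕ} {β : Type*} [MeasurableSpace β]
    (g : Equiv.Perm (Fin n) → β) : Measurable fun S : Fin n → ℝ => g (Tuple.sort S) := by
  intro s _
  have : (fun S : Fin n → ℝ => g (Tuple.sort S)) ⁻¹' s =
      ⋃ σ, ⋃ _ : g σ ∈ s, {S | Tuple.sort S = σ} := by
    ext S
    simp
  rw [this]
  exact .iUnion fun σ => .iUnion fun _ => measurableSet_sort_eq σ

/-- The index of the point at position `k` of the sorted sample; positions beyond the sample are
identified with the last one. -/
def pointAt {m : ℕ} (σ : Equiv.Perm (Fin (m + 1))) (k : ℕ) : Fin (m + 1) := σ (Fin.clamp k m)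

/-- The learner: dyadic refinement on the sample sorted by `σ`. -/
def sortedLearner (d : ℕ) : (n : ℕ) → Equiv.Perm (Fin n) → QueryTree n
  | 0, _ => .output fun _ => true
  | m + 1, σ => .dyadic d (pointAt σ) (fun i => (σ.symm i : ℕ)) (Nat.clog 2 (m + 1))

section sorted

variable {m : ℕ} (S : Fin (m + 1) → ℝ)

lemma monotone_sorted : Monotone fun k => S (pointAt (Tuple.sort S) k) :=
  (Tuple.monotone_sort S).comp Fin.clamp_monotone

lemma pointAt_symm (σ : Equiv.Perm (Fin (m + 1))) (i : Fin (m + 1)) :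
    pointAt σ (σ.symm i : ℕ) = i := by
  have : Fin.clamp (σ.symm i : ℕ) m = σ.symm i := by
    ext
    simp [Fin.clamp]
    omega
  rw [pointAt, this, Equiv.apply_symm_apply]

lemma changes_sorted_le {d : ℕ} {h : ℝ → Bool} (hh : h ∈ PTF d) (s k : ℕ) :
    changes (fun j => (h ∘ S) (pointAt (Tuple.sort S) (j * s))) k ≤ d :=
  changes_le_of_mem_PTF hh (x := fun j => S (pointAt (Tuple.sort S) (j * s)))
    (fun _ _ hij => monotone_sorted S (Nat.mul_le_mul_right s hij)) k

/-- Few sample points lie strictly between two positions of the sorted sample. -/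
lemma between_lt_of_mem_Ioo {k s : ℕ} (hs : 1 ≤ s) {u v : ℝ}
    (hu : u ∈ Set.Ioo (S (pointAt (Tuple.sort S) (k * s)))
      (S (pointAt (Tuple.sort S) ((k + 1) * s))))
    (hv : v ∈ Set.Ioo (S (pointAt (Tuple.sort S) (k * s)))
      (S (pointAt (Tuple.sort S) ((k + 1) * s)))) : between S u v < s := by
  classical
  set σ := Tuple.sort S
  -- The sample points counted have sorted positions strictly between `k * s` and `(k + 1) * s`, of
  -- which there are only `s - 1`.
  have hcard : between S u v ≤ (Finset.Ioo (k * s) ((k + 1) * s)).card := by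
    refine Finset.card_le_card_of_injOn (fun i => (σ.symm i : ℕ)) (fun i hi => ?_)
      (fun i _ j _ hij => σ.symm.injective (Fin.ext hij))
    rw [Finset.mem_coe, Finset.mem_filter] at hi
    have h1 := (lt_min hu.1 hv.1).trans hi.2.1
    have h2 := hi.2.2.trans (max_lt hu.2 hv.2)
    rw [Finset.mem_coe, Finset.mem_Ioo]
    constructor <;> by_contra! hle
    · have := monotone_sorted S hle
      simp only [σ, pointAt_symm] at this
      exact absurd h1 this.not_gt
    · have := monotone_sorted S hle
      simp only [σ, pointAt_symm] at this
      exact absurd h2 this.not_gt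
  rw [Nat.card_Ioo, add_mul] at hcard
  omega

/-- Two roots in one grid gap would have fewer than `s` sample points between them. The endpoint
conditions put the first and last grid points outside the range of the roots, so every root produces
its own change. -/
lemma le_changes_of_separates {d : ℕ} {a : ℝ} (ha : a ≠ 0) {r : Fin d → ℝ}
    (hr01 : ∀ i, r i ∈ Set.Ioo (0 : ℝ) 1) (hr : ∀ i k, r i ≠ S k) {s k : ℕ} (hs : 1 ≤ s)
    (hk : m + 1 ≤ k * s) (hsep : Separates s S r) :
    d ≤ changes (fun j => (rootsPTF a r ∘ S) (pointAt (Tuple.sort S) (j * s))) k := by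
  set σ := Tuple.sort S
  refine le_changes_rootsPTF ha (x := fun j => S (pointAt σ (j * s)))
    (fun _ _ hij => monotone_sorted S (Nat.mul_le_mul_right s hij)) (fun i _ => hr i _) ?_ ?_ ?_
  · intro i
    obtain ⟨j, hj⟩ := one_le_between.1 (hs.trans (hsep.2 i).1)
    rw [Set.uIoo_of_le (hr01 i).1.le] at hj
    have h := monotone_sorted S (show 0 * s ≤ (σ.symm j : ℕ) by simp)
    simp only [σ, pointAt_symm] at h
    exact h.trans_lt hj.2
  · intro i
    obtain ⟨j, hj⟩ := one_le_between.1 (hs.trans (hsep.2 i).2)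
    rw [Set.uIoo_of_ge (hr01 i).2.le] at hj
    have h := monotone_sorted S (show (σ.symm j : ℕ) ≤ k * s by omega)
    simp only [σ, pointAt_symm] at h
    exact hj.1.trans_le h
  · intro i j k hi hj
    by_contra hne
    exact absurd (hsep.1 i j hne) (between_lt_of_mem_Ioo S hs hi hj).not_ge

end sorted

lemma run_sortedLearner {n d : ℕ} (S : Fin n → ℝ) {h : ℝ → Bool} (hh : h ∈ PTF d) :
    (sortedLearner d n (Tuple.sort S)).run (h ∘ S) = h ∘ S := by
  cases n with
  | zero => exact Subsingleton.elim _ _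
  | succ m =>
    refine QueryTree.run_dyadic (pointAt_symm _) (fun i => ?_) (changes_sorted_le S hh)
    have := Nat.le_pow_clog one_lt_two (m + 1)
    omega

-- Level `j` has spacing `2 ^ (J - j)`, where `J` is the number of levels; it needs all `2 ^ j`
-- midpoints only if the sample does not separate the roots at that scale.
open Classical in
lemma queries_sortedLearner {m d : ℕ} {a : ℝ} (ha : a ≠ 0) (S : Fin (m + 1) → ℝ) :
    ∀ᵐ r ∂(Measure.pi fun _ : Fin d => unif01),
      ((sortedLearner d (m + 1) (Tuple.sort S)).queries (rootsPTF a r ∘ S) : ℝ≥0∞) ≤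
      2 + ∑ j ∈ Finset.range (Nat.clog 2 (m + 1)), ((d : ℝ≥0∞) +
        2 ^ j * {r | ¬ Separates (2 ^ (Nat.clog 2 (m + 1) - j)) S r}.indicator 1 r) := by
  filter_upwards [ae_roots_generic (d := d) S] with r hr
  set J := Nat.clog 2 (m + 1) with hJ
  have h := QueryTree.queries_dyadic (pos := fun i => ((Tuple.sort S).symm i : ℕ)) (J := J)
    (changes_sorted_le S (rootsPTF_mem_PTF a r))
  refine (Nat.cast_le.2 h).trans ?_
  push_cast
  gcongr with j hj
  have hj := Finset.mem_range.1 hj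
  by_cases hs : Separates (2 ^ (J - j)) S r
  · rw [if_neg]
    · exact zero_le
    · rw [not_lt]
      refine le_changes_of_separates S ha hr.1 hr.2 Nat.one_le_two_pow ?_ hs
      rw [← pow_add, Nat.add_sub_cancel' hj.le]
      exact Nat.le_pow_clog one_lt_two _
  · rw [Set.indicator_of_mem (by exact hs), Pi.one_apply, mul_one]
    split_ifs
    · exact le_rfl
    · exact zero_le

lemma two_pow_clog_le {n : ℕ} (hn : 1 ≤ n) : 2 ^ Nat.clog 2 n ≤ 2 * n := by
  rcases Nat.eq_or_lt_of_le hn with rfl | h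
  · simp
  · have h1 := Nat.pow_pred_clog_lt_self one_lt_two h
    have h2 : Nat.clog 2 n = (Nat.clog 2 n).pred + 1 :=
      (Nat.succ_pred_eq_of_pos (Nat.clog_pos one_lt_two h)).symm
    rw [h2, pow_succ]
    omega

/-- The level cancels: `2 ^ j` midpoints times probability `24 d² 2 ^ (J - j) / (n + 1)` is at most
`48 d²`, because `2 ^ J ≤ 2 n`. Adding `d ≤ d²` gives `49 d²` per level. -/
lemma lintegral_queries_sortedLearner_le {n d : ℕ} (hd : 1 ≤ d) {a : ℝ} (ha : a ≠ 0) :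
    ∫⁻ S, ∫⁻ r, ((sortedLearner d n (Tuple.sort S)).queries (rootsPTF a r ∘ S) : ℝ≥0∞)
      ∂(Measure.pi fun _ : Fin d => unif01) ∂(Measure.pi fun _ : Fin n => unif01) ≤
      ((2 + Nat.clog 2 n * (49 * d ^ 2) : ℕ) : ℝ≥0∞) := by
  cases n with
  | zero => simp [sortedLearner, QueryTree.queries]
  | succ m =>
    set J := Nat.clog 2 (m + 1) with hJ
    set μ := Measure.pi fun _ : Fin (m + 1) => unif01
    set ν := Measure.pi fun _ : Fin d => unif01
    have hmS : ∀ s, Measurable fun S : Fin (m + 1) → ℝ => ν {r | ¬ Separates s S r} := fun s =>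
      measurable_measure_prodMk_left measurableSet_not_separates
    have hmr : ∀ s (S : Fin (m + 1) → ℝ), MeasurableSet {r : Fin d → ℝ | ¬ Separates s S r} :=
      fun s S => measurable_prodMk_left measurableSet_not_separates
    calc _ ≤ ∫⁻ S, (2 + ∑ j ∈ Finset.range J, ((d : ℝ≥0∞) +
          2 ^ j * ν {r | ¬ Separates (2 ^ (J - j)) S r})) ∂μ := by
          refine lintegral_mono fun S => (lintegral_mono_ae (queries_sortedLearner ha S)).trans ?_
          rw [lintegral_add_left measurable_const, lintegral_finsetSum, lintegral_const,
            measure_univ, mul_one]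
          · refine add_le_add_right (Finset.sum_le_sum fun j _ => ?_) _
            rw [lintegral_add_left measurable_const, lintegral_const, measure_univ, mul_one,
              lintegral_const_mul _ (measurable_one.indicator (hmr _ S)),
              lintegral_indicator_one (hmr _ S)]
          · exact fun j _ => ((measurable_one.indicator (hmr _ S)).const_mul _).const_add _
      _ = 2 + ∑ j ∈ Finset.range J, ((d : ℝ≥0∞) +
          2 ^ j * ∫⁻ S, ν {r | ¬ Separates (2 ^ (J - j)) S r} ∂μ) := by
          rw [lintegral_add_left measurable_const, lintegral_finsetSum, lintegral_const,
            measure_univ, mul_one]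
          · congr 1
            refine Finset.sum_congr rfl fun j _ => ?_
            rw [lintegral_add_left measurable_const, lintegral_const, measure_univ, mul_one,
              lintegral_const_mul _ (hmS _)]
          · exact fun j _ => measurable_const.add ((hmS _).const_mul _)
      _ ≤ 2 + ∑ j ∈ Finset.range J, ((49 * d ^ 2 : ℕ) : ℝ≥0∞) := by
          refine add_le_add_right (Finset.sum_le_sum fun j hj => ?_) _
          have hj := (Finset.mem_range.1 hj).le
          have h1 := lintegral_not_separates_le (n := m + 1) (d := d) (s := 2 ^ (J - j))
            Nat.one_le_two_pow
          have h2 : (2 : ℝ≥0∞) ^ j * ENNReal.ofReal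
              (24 * (d : ℝ) ^ 2 * (2 ^ (J - j) : ℕ) / ((m + 1 : ℕ) + 1)) ≤
              ((48 * d ^ 2 : ℕ) : ℝ≥0∞) := by
            rw [← ENNReal.ofReal_ofNat, ← ENNReal.ofReal_pow zero_le_two,
              ← ENNReal.ofReal_mul (by positivity), ← ENNReal.ofReal_natCast]
            refine ENNReal.ofReal_le_ofReal ?_
            have h3 : (2 : ℝ) ^ j * (2 ^ (J - j) : ℕ) ≤ 2 * (m + 1 : ℕ) := by
              have := two_pow_clog_le (n := m + 1) (by omega)
              have h4 : 2 ^ j * 2 ^ (J - j) = 2 ^ J := by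
                rw [← pow_add, Nat.add_sub_cancel' hj]
              rw [← hJ, ← h4] at this
              exact_mod_cast this
            have h5 : (2 : ℝ) ^ j * (24 * (d : ℝ) ^ 2 * (2 ^ (J - j) : ℕ) / ((m + 1 : ℕ) + 1)) =
              24 * (d : ℝ) ^ 2 * ((2 : ℝ) ^ j * (2 ^ (J - j) : ℕ)) / ((m + 1 : ℕ) + 1) := by ring
            rw [h5, div_le_iff₀ (by positivity)]
            calc _ ≤ 24 * (d : ℝ) ^ 2 * (2 * (m + 1 : ℕ)) := by gcongr
              _ ≤ 24 * (d : ℝ) ^ 2 * (2 * ((m + 1 : ℕ) + 1)) := by gcongr; linarith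
              _ = _ := by push_cast; ring
          calc _ ≤ (d : ℝ≥0∞) + ((48 * d ^ 2 : ℕ) : ℝ≥0∞) := by
                refine add_le_add_right (le_trans ?_ h2) _
                gcongr
            _ ≤ _ := by
                rw [← Nat.cast_add]
                exact Nat.cast_le.2 (by nlinarith)
      _ = _ := by
          rw [Finset.sum_const, Finset.card_range, nsmul_eq_mul]
          push_cast
          ring

lemma perfectlyLearnable_uniformRoots {d : ℕ} (hd : 1 ≤ d) {a : ℝ} (ha : a ≠ 0) :
    PerfectlyLearnable unif01 (uniformRoots a d) (PTF d)
      fun n => ((2 + Nat.clog 2 n * (49 * d ^ 2) : ℕ) : ℝ≥0) := by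
  refine ⟨fun n => Kernel.deterministic (fun S => sortedLearner d n (Tuple.sort S))
    (measurable_comp_sort _), fun n => inferInstance, fun n S _ h hh => ?_, fun n => ?_⟩
  · rw [Kernel.deterministic_apply, ae_dirac_iff (MeasurableSpace.measurableSet_top)]
    exact run_sortedLearner S hh
  · have h : ∀ S : Fin n → ℝ, ∫⁻ h, ∫⁻ t, (t.queries (h ∘ S) : ℝ≥0∞)
        ∂(Kernel.deterministic (fun S => sortedLearner d n (Tuple.sort S))
          (measurable_comp_sort _) S) ∂(uniformRoots a d) =
        ∫⁻ r, ((sortedLearner d n (Tuple.sort S)).queries (rootsPTF a r ∘ S) : ℝ≥0∞)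
          ∂(Measure.pi fun _ : Fin d => unif01) := by
      intro S
      simp_rw [Kernel.deterministic_apply]
      rw [← lintegral_uniformRoots a S fun l => ((sortedLearner d n (Tuple.sort S)).queries l : ℝ≥0∞)]
      refine lintegral_congr fun h => ?_
      exact lintegral_dirac' _ measurable_from_top
    simp_rw [h]
    exact_mod_cast lintegral_queries_sortedLearner_le hd ha

/-- The factor `log (max d 2)` is only used through its lower bound `1 / 2`, and `Nat.clog 2 n ≤ 4
log n`; the constant is `400 = 2 * 4 * (1 + 49)`. -/
lemma clog_bound_le {d n : ℕ} (hd : 1 ≤ d) (hn : 2 ≤ n) :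
    ((2 + Nat.clog 2 n * (49 * d ^ 2) : ℕ) : ℝ) ≤
      400 * (d : ℝ) ^ 2 * Real.log (max (d : ℝ) 2) * Real.log n := by
  have hl2 : (1 : ℝ) / 2 ≤ Real.log 2 := by linarith [Real.log_two_gt_d9]
  have hn' : (2 : ℝ) ≤ n := by exact_mod_cast hn
  have hln : Real.log 2 ≤ Real.log n := Real.log_le_log two_pos hn'
  have hlm : Real.log 2 ≤ Real.log (max (d : ℝ) 2) := Real.log_le_log two_pos (le_max_right _ _)
  have hclog : (Nat.clog 2 n : ℝ) * Real.log 2 ≤ 2 * Real.log n := by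
    have h1 : (2 : ℝ) ^ Nat.clog 2 n ≤ 2 * n := by
      exact_mod_cast two_pow_clog_le (n := n) (by omega)
    have h2 := Real.log_le_log (by positivity) h1
    rw [Real.log_pow, Real.log_mul two_ne_zero (by positivity)] at h2
    linarith
  have hc0 : (0 : ℝ) ≤ Nat.clog 2 n := by positivity
  have hclog' : (Nat.clog 2 n : ℝ) ≤ 4 * Real.log n := by nlinarith
  have hd' : (1 : ℝ) ≤ (d : ℝ) ^ 2 := one_le_pow₀ (by exact_mod_cast hd)
  have hln0 : 0 < Real.log n := by linarith
  calc ((2 + Nat.clog 2 n * (49 * d ^ 2) : ℕ) : ℝ) = 2 + Nat.clog 2 n * (49 * (d : ℝ) ^ 2) := by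
        push_cast; ring
    _ ≤ 4 * Real.log n * (d : ℝ) ^ 2 + 4 * Real.log n * (49 * (d : ℝ) ^ 2) := by
        gcongr
        nlinarith
    _ = 400 * (d : ℝ) ^ 2 * (1 / 2) * Real.log n := by ring
    _ ≤ _ := by
        gcongr
        linarith

theorem mainTheorem6 :
    ∃ c C K : ℝ, 0 < c ∧ 0 < C ∧ 0 < K ∧
      ∀ d : ℕ, 1 ≤ d → ∀ a : ℝ, a ≠ 0 →
        (∃ q : ℕ → ℝ≥0, PerfectlyLearnable unif01 (uniformRoots a d) (PTF d) q ∧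
          ∀ n : ℕ, 2 ≤ n →
            (q n : ℝ) ≤ C * (d : ℝ) ^ 2 * Real.log (max (d : ℝ) 2) * Real.log n) ∧
        (∀ q : ℕ → ℝ≥0, PerfectlyLearnable unif01 (uniformRoots a d) (PTF d) q →
          ∀ n : ℕ, K * (d : ℝ) ^ 2 ≤ n → c * d * Real.log n ≤ q n) := by
  refine ⟨1 / 32, 400, 2 ^ 88, by norm_num, by norm_num, by norm_num, fun d hd a ha => ⟨?_, ?_⟩⟩
  · exact ⟨_, perfectlyLearnable_uniformRoots hd ha, fun n hn => clog_bound_le hd hn⟩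
  · exact fun q hq n hn => lower_bound hd ha hq hn
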